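/- **Setting.** Let $N=\{1,\dots,n\}$ be a set of items and $\Gamma$ a finite set of states. A partial realization is $b\in(\Gamma\cup\{*\})^n$; $b'\succeq b$ means $b'_i=b_i$ whenever $b_i\ne *$, and $b_{i\leftarrow\gamma}$ is $b$ with $i$-th entry replaced by $\gamma$. For $g:(\Gamma\cup\{*\})^n\to\mathbb Z_{\ge 0}$ put $\Delta g(b,i,\gamma)=g(b_{i\leftarrow\gamma})-g(b)$. Call $g$ monotone if $\Delta g(b,i,\gamma)\ge 0$ whenever $b_i=*$, submodular if moreover $\Delta g(b,i,\gamma)\ge\Delta g(b',i,\gamma)$ whenever $b'\succ b$ and $b_i=b'_i=*$, and say that $g$ has goal value $Q$ if $g(a)=Q$ for all $a\in\Gamma^n$. For $g$ with goal value $Q$ let $$\rho=\min\frac{\Delta g(b,i,\gamma)}{Q-g(b)}$$ over all $b,i,\gamma$ with $g(b)<Q$, $b_i=*$ and $\gamma\neq\gamma_{b,i}$, where $\gamma_{b,i}$ is a state minimizing $\Delta g(b,i,\cdot)$ (the minimum of the empty set is $+\infty$). An instance of Scenario Submodular Cover is a tuple $(g,Q,S,w,c)$, where $g$ is monotone and submodular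 with goal value $Q>0$, $S\subseteq\Gamma^n$ is a nonempty sample of size $m=|S|$, $w(a)\in\mathbb Z_{>0}$ for $a\in S$, and $c\in\mathbb R_{>0}^n$. A strategy is a decision tree whose internal nodes are labelled with items (never repeated on a path), with one child for each state, such that the partial realization $b$ of each root-leaf path satisfies $g(b)=Q$. Its expected cost is the expected total cost of the items on the path followed by a random $a\in S$ drawn with probability proportional to $w(a)$. **Mixed Greedy.** For a utility function $g$ with goal value $Q$, the recursive procedure $\mathrm{MixedGreedy}(b)$ returns a leaf if $g(b)=Q$. Otherwise: 1. Let $N'=\{i: b_i=*\}$; for $i\in N'$ let $\sigma_i$ be a state minimizing $\Delta g(b,i,\cdot)$; for $U\subseteq N'$ let $b_U$ be $b$ with each $i\in U$ set to $\sigma_i$, and $g'(U)=g(b_U)-g(b)$. 2. Let $\chi$ be the solution of $e^\chi=2-\chi$ and $\alpha=1-e^{-\chi}$. Let $B$ be the smallest number in $[0,\sum_{i\in N'}c_i]$ for which Wolsey's greedy algorithm with budget $B$ returns a set of $g'$-value at least $\alpha g'(N')$. That algorithm repeatedly adds an item $i\in N'$ with $c_i\le B$ that maximizes $(g'(R\cup\{i\})-g'(R))/c_i$,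 where $R$ is the set chosen so far, until the total cost exceeds $B$ or no such item is left; then it returns the last item alone or all the other chosen items, whichever has the larger $g'$-value. 3. Let $I=\{i\in N': c_i\le B\}$. First stage: choose items one after the other, each time an item of $I$ not yet chosen that maximizes $(h(R\cup\{i\})-h(R))/c_i$, where $R$ is the set chosen so far and $h(R)$ is the total weight of the $a\in S$ with $a\succeq b$ and $a_i\neq\sigma_i$ for some $i\in R$; this ends when the total cost of the items chosen is at least $B$. Second stage: choose further items, each time an item $i\in I$ not yet chosen that maximizes $\Delta g(b_R,i,\sigma_i)/c_i$, where $R$ is the set of all items chosen in both stages so far, until the cost spent in the second stage is at least $B$ or no item is left. 4. Return the tree with a path labelled by the chosen items in their order, where the $\sigma_i$-child of the node labelled $i$ is the next node of the path. For $\gamma\ne\sigma_i$, the $\gamma$-child of the node labelled $i$ is the root of $\mathrm{MixedGreedy}(b_{R}$ with $i$ set to $\gamma)$, where $R$ is the set of items before $i$; at the end of the path comes $\mathrm{MixedGreedy}(b_R)$, where $R$ is the set of all items chosen. Ties are broken arbitrarily (in step 2, by a rule that does not depend on $B$). **Scenario Mixed Greedy** on $(g,Q,S,w,c)$. Put $h_S(b)=m-|\{a\in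 S: a\succeq b\}|$ and $$g_S(b)=Qm-(Q-g(b))(m-h_S(b)).$$ Run Mixed Greedy from $b=(*,\dots,*)$ for $g_S$ with goal value $Qm$ (and $S,w,c$); afterwards, if the final partial realization $b$ does not satisfy $g(b)=Q$, choose the remaining items in a fixed but arbitrary order until it does. **Theorem 2.** There is an absolute constant $K>0$ such that for every instance $(g,Q,S,w,c)$ of Scenario Submodular Cover, with $m=|S|$: the value of $\rho$ for $g_S$ and the goal value $Qm$ is at least $\tfrac12$; Scenario Mixed Greedy produces an output; and each of its possible outputs is a strategy for $(g,Q,S,w,c)$, whose expected cost is at most $K\,(1+\ln(Qm))$ times the expected cost of any strategy for $(g,Q,S,w,c)$. That is, Scenario Mixed Greedy is an $O(\log Qm)$-approximation algorithm for Scenario Submodular Cover. -/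

import Mathlib

namespace ScenarioCover

universe u

/-- A partial realization: an element of `(Γ ∪ {*})^n`, with `none` in the role of `*`. -/
abbrev PartialRealization (n : ℕ) (Γ : Type u) : Type u := Fin n → Option Γ

/-- The partial realization `(*, …, *)`. -/
def allUnknown (n : ℕ) (Γ : Type u) : PartialRealization n Γ := fun _ => none

/-- A realization `a ∈ Γ^n`, seen as a partial realization. -/
def full {n : ℕ} {Γ : Type u} (a : Fin n → Γ) : PartialRealization n Γ := fun i => some (a i)

/-- `b_{i ← γ}`. -/
def setState {n : ℕ} {Γ : Type u} (b : PartialRealization n Γ) (i : Fin n) (γ : Γ) :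
    PartialRealization n Γ := Function.update b i (some γ)

/-- `b' ⪰ b`: `b'` is an extension of `b`. -/
def Extends {n : ℕ} {Γ : Type u} (b' b : PartialRealization n Γ) : Prop :=
  ∀ i, b i ≠ none → b' i = b i

/-- `Δg(b, i, γ) = g(b_{i ← γ}) - g(b)`. -/
def delta {n : ℕ} {Γ : Type u} (g : PartialRealization n Γ → ℕ) (b : PartialRealization n Γ)
    (i : Fin n) (γ : Γ) : ℤ := (g (setState b i γ) : ℤ) - (g b : ℤ)

/-- Monotonicity of a state-dependent utility function. -/
def IsMonotone {n : ℕ} {Γ : Type u} (g : PartialRealization n Γ → ℕ) : Prop :=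
  ∀ b i γ, b i = none → g b ≤ g (setState b i γ)

/-- The diminishing-returns property of a state-dependent utility function. -/
def IsSubmodular {n : ℕ} {Γ : Type u} (g : PartialRealization n Γ → ℕ) : Prop :=
  ∀ b b' i γ, Extends b' b → b' ≠ b → b i = none → b' i = none →
    delta g b' i γ ≤ delta g b i γ

/-- `g` has goal value `Q`: it equals `Q` on every realization. -/
def HasGoalValue {n : ℕ} {Γ : Type u} (g : PartialRealization n Γ → ℕ) (Q : ℕ) : Prop :=
  ∀ a : Fin n → Γ, g (full a) = Q

/-- `γ₀` is a worst-case state of item `i` at `b`: it minimizes `Δg(b, i, ·)`. -/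
def IsWorstState {n : ℕ} {Γ : Type u} (g : PartialRealization n Γ → ℕ)
    (b : PartialRealization n Γ) (i : Fin n) (γ₀ : Γ) : Prop :=
  ∀ γ, delta g b i γ₀ ≤ delta g b i γ

/-- The parameter `ρ`: the minimum of `Δg(b,i,γ) / (Q - g(b))` over `b` with `g(b) < Q`, items `i`
with `b_i = *`, and states `γ` different from the worst-case state of `i` at `b` (when several
states are worst-case, the set of values does not depend on which one is singled out).  It is `⊤`
when there is no such triple. -/
noncomputable def rho {n : ℕ} {Γ : Type u} (g : PartialRealization n Γ → ℕ) (Q : ℕ) : EReal :=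
  sInf {r : EReal | ∃ (b : PartialRealization n Γ) (i : Fin n) (γ₀ γ : Γ),
    g b < Q ∧ b i = none ∧ IsWorstState g b i γ₀ ∧ γ ≠ γ₀ ∧
    r = (((delta g b i γ : ℝ) / ((Q : ℝ) - (g b : ℝ)) : ℝ) : EReal)}

/-- An instance `(g, Q, S, w, c)` of Scenario Submodular Cover with `n` items and state set `Γ`.
Only the values of `w` on `S` matter. -/
structure ScenarioSC (n : ℕ) (Γ : Type u) where
  g : PartialRealization n Γ → ℕ
  Q : ℕ
  S : Finset (Fin n → Γ)
  w : (Fin n → Γ) → ℕ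
  c : Fin n → ℝ
  monotone_g : IsMonotone g
  submodular_g : IsSubmodular g
  goal_g : HasGoalValue g Q
  Q_pos : 0 < Q
  S_nonempty : S.Nonempty
  w_pos : ∀ a ∈ S, 0 < w a
  c_pos : ∀ i, 0 < c i

/-! ### Decision trees -/

/-- Decision trees: internal nodes are labelled with items and have one child for each state. -/
inductive DTree (n : ℕ) (Γ : Type u) : Type u
  | leaf : DTree n Γ
  | node (i : Fin n) (child : Γ → DTree n Γ) : DTree n Γ

/-- Started in the partial realization `b`, the tree never repeats an item, and it reaches utility
`Q` at each of its leaves. -/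
def CoversFrom {n : ℕ} {Γ : Type u} (g : PartialRealization n Γ → ℕ) (Q : ℕ) :
    DTree n Γ → PartialRealization n Γ → Prop
  | .leaf, b => g b = Q
  | .node i child, b => b i = none ∧ ∀ γ, CoversFrom g Q (child γ) (setState b i γ)

/-- The tree is a strategy for the utility function `g` and goal value `Q`: it achieves utility `Q`
on all realizations in `Γ^n`. -/
def IsStrategy {n : ℕ} {Γ : Type u} (g : PartialRealization n Γ → ℕ) (Q : ℕ)
    (T : DTree n Γ) : Prop :=
  CoversFrom g Q T (allUnknown n Γ)

/-- `κ(T, a)`: the cost incurred when using the tree `T` on the realization `a`. -/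
def pathCost {n : ℕ} {Γ : Type u} (c : Fin n → ℝ) : DTree n Γ → (Fin n → Γ) → ℝ
  | .leaf, _ => 0
  | .node i child, a => c i + pathCost c (child (a i)) a

/-- The expected cost of the tree `T` under the sample distribution defined by `S` and `w`. -/
noncomputable def expectedCost {n : ℕ} {Γ : Type u} (S : Finset (Fin n → Γ))
    (w : (Fin n → Γ) → ℕ) (c : Fin n → ℝ) (T : DTree n Γ) : ℝ :=
  ∑ a ∈ S, ((w a : ℝ) / (∑ a' ∈ S, (w a' : ℝ))) * pathCost c T a

/-! ### The greedy loops and Wolsey's algorithm -/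

/-- A way of breaking ties: a choice of an element in every nonempty set of items. -/
def IsTieRule {n : ℕ} (tie : Finset (Fin n) → Fin n) : Prop :=
  ∀ A : Finset (Fin n), A.Nonempty → tie A ∈ A

open scoped Classical in
/-- The items of `I` that maximize `gain i / c i`. -/
noncomputable def bestItems {n : ℕ} (c : Fin n → ℝ) (gain : Fin n → ℝ) (I : Finset (Fin n)) :
    Finset (Fin n) :=
  I.filter (fun i => ∀ j ∈ I, gain j / c j ≤ gain i / c i)

open scoped Classical in
/-- The sequence of items chosen by a greedy loop, started with the set `I` of available items, the
set `R` of items chosen so far, and the amount `spent`.  Each round moves to `R` an item `i ∈ I`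
that maximizes `gain R i / c i` and adds `c i` to `spent`.  The loop ends when `halt spent` holds
or no item is left.  (For a valid tie rule, the membership test below fails only for `I = ∅`.) -/
noncomputable def greedyLoop {n : ℕ} (c : Fin n → ℝ) (gain : Finset (Fin n) → Fin n → ℝ)
    (tie : Finset (Fin n) → Fin n) (halt : ℝ → Prop)
    (I R : Finset (Fin n)) (spent : ℝ) : List (Fin n) :=
  if h : ¬ halt spent ∧ tie (bestItems c (gain R) I) ∈ I then
    tie (bestItems c (gain R) I) ::
      greedyLoop c gain tie halt (I.erase (tie (bestItems c (gain R) I)))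
        (insert (tie (bestItems c (gain R) I)) R)
        (spent + c (tie (bestItems c (gain R) I)))
  else []
termination_by I.card
decreasing_by exact Finset.card_erase_lt_of_mem h.2

open scoped Classical in
/-- Wolsey's greedy algorithm for maximizing `f` over subsets of `N` of cost at most `B`: items of
cost at most `B` are added greedily until the budget is exceeded or no item is left; then either
the last item alone or the set of all the others is returned, whichever has the larger value. -/
noncomputable def wolseyGreedy {n : ℕ} (c : Fin n → ℝ) (tie : Finset (Fin n) → Fin n)
    (N : Finset (Fin n)) (f : Finset (Fin n) → ℝ) (B : ℝ) : Finset (Fin n) :=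
  let l := greedyLoop c (fun R i => f (insert i R) - f R) tie (fun spent => B < spent)
    (N.filter (fun i => c i ≤ B)) ∅ 0
  match l.getLast? with
  | none => ∅
  | some i => if f (l.toFinset.erase i) ≤ f {i} then {i} else l.toFinset.erase i

theorem exists_chi : ∃ x : ℝ, Real.exp x = 2 - x := by
  have hc : ContinuousOn (fun x : ℝ => Real.exp x + x) (Set.Icc 0 1) := by fun_prop
  have h1 : (2 : ℝ) ∈ Set.Icc (Real.exp 0 + 0) (Real.exp 1 + 1) := by
    constructor
    · norm_num
    · linarith [Real.add_one_le_exp (1 : ℝ)]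
  obtain ⟨x, -, hx⟩ := intermediate_value_Icc (zero_le_one' ℝ) hc h1
  exact ⟨x, by simp only at hx; linarith⟩

/-- The (unique) solution `χ` of `e^χ = 2 - χ`. -/
noncomputable def chi : ℝ := Classical.choose exists_chi

/-- `α = 1 - e^{-χ} ≈ 0.35`. -/
noncomputable def alpha : ℝ := 1 - Real.exp (-chi)

/-- `B` is the value of `FindBudget(N, f, c)`: the smallest budget in `[0, ∑_{i ∈ N} c_i]` for
which Wolsey's greedy algorithm returns a set of utility at least `α f(N)`. -/
def IsBudget {n : ℕ} (c : Fin n → ℝ) (tie : Finset (Fin n) → Fin n)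
    (N : Finset (Fin n)) (f : Finset (Fin n) → ℝ) (B : ℝ) : Prop :=
  IsLeast {B : ℝ | 0 ≤ B ∧ B ≤ ∑ i ∈ N, c i ∧ alpha * f N ≤ f (wolseyGreedy c tie N f B)} B

/-! ### Mixed Greedy -/

open scoped Classical in
/-- The set `{i | b_i = *}` of items whose state is unknown. -/
noncomputable def unknownItems {n : ℕ} {Γ : Type u} (b : PartialRealization n Γ) :
    Finset (Fin n) :=
  Finset.univ.filter (fun i => b i = none)

/-- The partial realization obtained from `b` by giving every item `i ∈ U` the state `σ_i`. -/
def assign {n : ℕ} {Γ : Type u} (σ : Fin n → Γ) (b : PartialRealization n Γ)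
    (U : Finset (Fin n)) : PartialRealization n Γ :=
  fun i => if i ∈ U then some (σ i) else b i

/-- The set function `g'(U) = g(b_U) - g(b)`. -/
def gainFrom {n : ℕ} {Γ : Type u} (g : PartialRealization n Γ → ℕ) (σ : Fin n → Γ)
    (b : PartialRealization n Γ) (U : Finset (Fin n)) : ℝ :=
  (g (assign σ b U) : ℝ) - (g b : ℝ)

open scoped Classical in
/-- `h(R)`: the total weight of the `a ∈ S` with `a ⪰ b` and `a_i ≠ σ_i` for some `i ∈ R`. -/
noncomputable def removedWeight {n : ℕ} {Γ : Type u} (S : Finset (Fin n → Γ))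
    (w : (Fin n → Γ) → ℕ) (σ : Fin n → Γ) (b : PartialRealization n Γ) (R : Finset (Fin n)) : ℝ :=
  ∑ a ∈ S.filter (fun a => Extends (full a) b ∧ ∃ i ∈ R, a i ≠ σ i), (w a : ℝ)

open scoped Classical in
/-- The items chosen in the first stage: among the unknown items of cost at most `B`, maximize the
weight removed per unit cost, until the amount spent is at least `B`. -/
noncomputable def stageOne {n : ℕ} {Γ : Type u} (S : Finset (Fin n → Γ)) (w : (Fin n → Γ) → ℕ)
    (c : Fin n → ℝ) (tie : Finset (Fin n) → Fin n) (σ : Fin n → Γ) (b : PartialRealization n Γ)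
    (B : ℝ) : List (Fin n) :=
  greedyLoop c (fun R i => removedWeight S w σ b (insert i R) - removedWeight S w σ b R) tie
    (fun spent => B ≤ spent) ((unknownItems b).filter (fun i => c i ≤ B)) ∅ 0

open scoped Classical in
/-- The items chosen in the second stage, after the items of `R₁` were chosen in the first: among
the remaining items of cost at most `B`, maximize the utility gained per unit cost if item `i` has
state `σ_i`, until the amount spent in this stage is at least `B` or no item is left. -/
noncomputable def stageTwo {n : ℕ} {Γ : Type u} (g : PartialRealization n Γ → ℕ)
    (c : Fin n → ℝ) (tie : Finset (Fin n) → Fin n) (σ : Fin n → Γ) (b : PartialRealization n Γ)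
    (B : ℝ) (R₁ : Finset (Fin n)) : List (Fin n) :=
  greedyLoop c (fun R i => (delta g (assign σ b R) i (σ i) : ℝ)) tie
    (fun spent => B ≤ spent) ((unknownItems b).filter (fun i => c i ≤ B) \ R₁) R₁ 0

open scoped Classical in
/-- The tree with a path of nodes labelled by the given items, where the `σ_i`-child of the node
labelled `i` is the next node of the path (`last` at the end of the path), and its `γ`-child for
`γ ≠ σ_i` is `side i γ`. -/
noncomputable def backbone {n : ℕ} {Γ : Type u} (σ : Fin n → Γ) (side : Fin n → Γ → DTree n Γ)
    (last : DTree n Γ) : List (Fin n) → DTree n Γ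
  | [] => last
  | i :: l => .node i (fun γ => if γ = σ i then backbone σ side last l else side i γ)

/-- `MixedGreedy g Q S w c b T`: the recursive procedure `MixedGreedy(g, Q, S, w, c, b)` can return
the tree `T`.  All ties (in the choice of `σ`, in Wolsey's algorithm, in the two stages) are broken
arbitrarily, anew in each recursive call. -/
inductive MixedGreedy {n : ℕ} {Γ : Type u} (g : PartialRealization n Γ → ℕ) (Q : ℕ)
    (S : Finset (Fin n → Γ)) (w : (Fin n → Γ) → ℕ) (c : Fin n → ℝ) :
    PartialRealization n Γ → DTree n Γ → Prop
  | leaf (b : PartialRealization n Γ) (hb : g b = Q) : MixedGreedy g Q S w c b .leaf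
  | node (b : PartialRealization n Γ) (σ : Fin n → Γ) (B : ℝ)
      (tie₀ tie₁ tie₂ : Finset (Fin n) → Fin n) (l₁ l₂ : List (Fin n))
      (side : Fin n → Γ → DTree n Γ) (last : DTree n Γ)
      (hb : g b ≠ Q)
      (hσ : ∀ i, b i = none → IsWorstState g b i (σ i))
      (h_tie₀ : IsTieRule tie₀) (h_tie₁ : IsTieRule tie₁) (h_tie₂ : IsTieRule tie₂)
      (hB : IsBudget c tie₀ (unknownItems b) (gainFrom g σ b) B)
      (h_stage₁ : l₁ = stageOne S w c tie₁ σ b B)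
      -- the first loop has no other exit than this condition
      (h_spent : B ≤ (l₁.map c).sum)
      (h_stage₂ : l₂ = stageTwo g c tie₂ σ b B l₁.toFinset)
      (h_side : ∀ (pre post : List (Fin n)) (i : Fin n), l₁ ++ l₂ = pre ++ i :: post →
        ∀ γ, γ ≠ σ i →
          MixedGreedy g Q S w c (setState (assign σ b pre.toFinset) i γ) (side i γ))
      (h_last : MixedGreedy g Q S w c (assign σ b (l₁ ++ l₂).toFinset) last) :
      MixedGreedy g Q S w c b (backbone σ side last (l₁ ++ l₂))

/-! ### Scenario Mixed Greedy -/

/-- The standard OR construction `Q₁Q₂ - (Q₁ - g₁)(Q₂ - g₂)`, for functions with `g₁ ≤ Q₁` and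
`g₂ ≤ Q₂`. -/
def orConstruction {n : ℕ} {Γ : Type u} (g₁ : PartialRealization n Γ → ℕ) (Q₁ : ℕ)
    (g₂ : PartialRealization n Γ → ℕ) (Q₂ : ℕ) : PartialRealization n Γ → ℕ :=
  fun b => Q₁ * Q₂ - (Q₁ - g₁ b) * (Q₂ - g₂ b)

open scoped Classical in
/-- `h_S(b) = m - |{a ∈ S : a ⪰ b}|` with `m = |S|`. -/
noncomputable def eliminated {n : ℕ} {Γ : Type u} (S : Finset (Fin n → Γ)) :
    PartialRealization n Γ → ℕ :=
  fun b => S.card - (S.filter (fun a => Extends (full a) b)).card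

/-- `g_S`, the OR construction applied to `g` with goal `Q` and `h_S` with goal `m`. -/
noncomputable def ScenarioSC.gS {n : ℕ} {Γ : Type u} (P : ScenarioSC n Γ) :
    PartialRealization n Γ → ℕ :=
  orConstruction P.g P.Q (eliminated P.S) P.S.card

open scoped Classical in
/-- From `b`, choose the items of the list that are still unknown, in the order of the list, until
the utility is `Q`. -/
noncomputable def chooseInOrder {n : ℕ} {Γ : Type u} (g : PartialRealization n Γ → ℕ) (Q : ℕ) :
    List (Fin n) → PartialRealization n Γ → DTree n Γ
  | [], _ => .leaf
  | i :: l, b =>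
    if g b = Q then .leaf
    else if b i = none then .node i (fun γ => chooseInOrder g Q l (setState b i γ))
    else chooseInOrder g Q l b

/-- Follow the tree (from the partial realization `b`), and at its leaves go on with the remaining
items in the given order until the utility is `Q`. -/
noncomputable def complete {n : ℕ} {Γ : Type u} (g : PartialRealization n Γ → ℕ) (Q : ℕ)
    (order : List (Fin n)) : DTree n Γ → PartialRealization n Γ → DTree n Γ
  | .leaf, b => chooseInOrder g Q order b
  | .node i child, b => .node i (fun γ => complete g Q order (child γ) (setState b i γ))

/-- `T` is a strategy that Scenario Mixed Greedy can produce on the instance `P`: run Mixed Greedy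
on `g_S` with goal value `Qm`, starting from `(*, …, *)`, then, where `g` has not reached `Q`,
choose the remaining items in a fixed but arbitrary order until it has. -/
def ScenarioMixedGreedy {n : ℕ} {Γ : Type u} (P : ScenarioSC n Γ) (T : DTree n Γ) : Prop :=
  ∃ (T₀ : DTree n Γ) (order : List (Fin n)),
    MixedGreedy P.gS (P.Q * P.S.card) P.S P.w P.c (allUnknown n Γ) T₀ ∧
    order.Nodup ∧ (∀ i, i ∈ order) ∧
    T = complete P.g P.Q order T₀ (allUnknown n Γ)

end ScenarioCover

/-! The distance of `g_S` from its goal is a product, `Qm - g_S(b) = (Q - g(b)) · |{a ∈ S : a ⪰ b}|`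
(`goal_sub_gS`). The states of an item split the samples consistent with `b` into disjoint classes,
so at most one state keeps more than half of them, and every other state halves the product. If a
state other than the worst one keeps more than half, then the worst state keeps at most half, hence
gains at least half of the distance, and the former gains no less. This is `ρ ≥ 1/2`
(`goal_sub_gS_le`).

Mixed Greedy is compared with an arbitrary strategy `T'`, one recursive call at a time. At `b`,
follow `T'` under the states recorded in `b` and, for unknown items, the states `σ`. The unknown
items met form a list `U` with `g(b_U)` equal to the goal, and on every consistent `a` the tree `T'`
pays at least the cost of `U` up to the first item where `a` departs from `σ` (`exists_path`). By
Wolsey's guarantee (`alpha_le_wolseyGreedy`) and the minimality of `B`, the cost of `U` is at least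
`B`. Against any such list, the greedy removal of weight in the first stage is an 8-approximation
(`sum_exitCost_le`). The second stage costs at most `2B` and is paid only by realizations that have
already spent `B`, so it at most triples the cost. Hence a backbone costs at most 24 times what `T'`
costs on the samples consistent with `b` (`sum_exitCost_stages_le`).

Every recursive call starts with the distance to the goal multiplied by at most `1 - α/2`: a call
off the backbone because of `ρ ≥ 1/2`, the call at its end because the second stage attains `α/2` of
the distance (`greedyRun_budget`). The recursion therefore has depth `O(log Qm)`. The calls made by
one call concern disjoint sets of samples, so each level of the recursion costs at most 24 times the
cost of `T'` (`cost_le`).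

Finally, at a leaf reached by a sample `a` the set of consistent samples is nonempty, so the product
vanishes only through `g = Q`; completing the tree costs nothing on `S` (`pathCost_complete`). An
output exists because the result of Wolsey's algorithm depends on the budget only through the subset
sums below it, so the smallest admissible budget is attained (`exists_isBudget`), and because the
affordable items always suffice to spend `B` (`stageOne_spends`). -/

namespace ScenarioCover

universe u

/-! ### Runs of the greedy loop -/

/-- The list records a run of the greedy loop from the available items, the chosen items and the
amount spent. -/
inductive GreedyRun {n : ℕ} (c : Fin n → ℝ) (gain : Finset (Fin n) → Fin n → ℝ)
    (halt : ℝ → Prop) : Finset (Fin n) → Finset (Fin n) → ℝ → List (Fin n) → Prop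
  | done {I R : Finset (Fin n)} {s : ℝ} (h : halt s ∨ I = ∅) : GreedyRun c gain halt I R s []
  | step {I R : Finset (Fin n)} {s : ℝ} {i : Fin n} {l : List (Fin n)} (h : ¬ halt s) (hi : i ∈ I)
      (hmax : ∀ j ∈ I, gain R j / c j ≤ gain R i / c i)
      (hl : GreedyRun c gain halt (I.erase i) (insert i R) (s + c i) l) :
      GreedyRun c gain halt I R s (i :: l)

section Greedy

variable {n : ℕ} {c : Fin n → ℝ} {gain : Finset (Fin n) → Fin n → ℝ} {halt : ℝ → Prop}
  {I R : Finset (Fin n)} {s : ℝ} {l : List (Fin n)}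

theorem bestItems_nonempty (c gain : Fin n → ℝ) (hI : I.Nonempty) :
    (bestItems c gain I).Nonempty := by
  obtain ⟨i, hi, hmax⟩ := I.exists_max_image (fun j => gain j / c j) hI
  exact ⟨i, by simp only [bestItems, Finset.mem_filter]; exact ⟨hi, hmax⟩⟩

theorem greedyLoop_run {tie : Finset (Fin n) → Fin n} (htie : IsTieRule tie)
    (I R : Finset (Fin n)) (s : ℝ) :
    GreedyRun c gain halt I R s (greedyLoop c gain tie halt I R s) := by
  induction hk : I.card using Nat.strong_induction_on generalizing I R s with
  | _ k ih =>
    rw [greedyLoop]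
    split_ifs with h
    · have hb := htie _ (bestItems_nonempty c (gain R) ⟨_, h.2⟩)
      simp only [bestItems, Finset.mem_filter] at hb
      refine .step h.1 h.2 hb.2 (ih _ ?_ _ _ _ rfl)
      rw [← hk]
      exact Finset.card_erase_lt_of_mem h.2
    · refine .done ?_
      by_contra! hne
      refine h ⟨hne.1, ?_⟩
      have hb := htie _ (bestItems_nonempty c (gain R) hne.2)
      exact (Finset.mem_filter.1 hb).1

theorem GreedyRun.mem (h : GreedyRun c gain halt I R s l) : ∀ i ∈ l, i ∈ I := by
  induction h with
  | done => simp
  | step _ hi _ _ ih =>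
    intro j hj
    rcases List.mem_cons.1 hj with rfl | hj
    · exact hi
    · exact Finset.mem_of_mem_erase (ih j hj)

theorem GreedyRun.nodup (h : GreedyRun c gain halt I R s l) : l.Nodup := by
  induction h with
  | done => simp
  | step _ hi _ hl ih =>
    refine List.nodup_cons.2 ⟨fun hmem => ?_, ih⟩
    simpa using hl.mem _ hmem

theorem GreedyRun.halt_or_exhausted (h : GreedyRun c gain halt I R s l) :
    halt (s + (l.map c).sum) ∨ ∀ i ∈ I, i ∈ l := by
  induction h with
  | done h => rcases h with h | h <;> simp [h]
  | @step I R s i l _ hi _ _ ih =>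
    rcases ih with ih | ih
    · left; simpa [add_assoc] using ih
    · right
      intro j hj
      by_cases hji : j = i
      · simp [hji]
      · simp [ih j (by simp [hji, hj])]

/-- Random access to a run: what held at the moment `k` was chosen. All later estimates look at a
run through this lemma. -/
theorem GreedyRun.split (h : GreedyRun c gain halt I R s l) {pre post : List (Fin n)} {k : Fin n}
    (hl : l = pre ++ k :: post) :
    ¬ halt (s + (pre.map c).sum) ∧ k ∈ I ∧ ∀ j ∈ I, j ∉ pre →
      gain (R ∪ pre.toFinset) j / c j ≤ gain (R ∪ pre.toFinset) k / c k := by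
  induction h generalizing pre with
  | done => simp at hl
  | @step I R s i l hs hi hmax _ ih =>
    cases pre with
    | nil =>
      simp only [List.nil_append, List.cons.injEq] at hl
      obtain ⟨rfl, rfl⟩ := hl
      simpa [hs, hi] using hmax
    | cons p pre =>
      simp only [List.cons_append, List.cons.injEq] at hl
      obtain ⟨rfl, hl⟩ := hl
      obtain ⟨h1, h2, h3⟩ := ih hl
      have hR : R ∪ (i :: pre).toFinset = insert i R ∪ pre.toFinset := by
        ext j; simp
      refine ⟨by simpa [add_assoc] using h1, Finset.mem_of_mem_erase h2, fun j hj hjp => ?_⟩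
      rw [hR]
      simp only [List.mem_cons, not_or] at hjp
      exact h3 j (by simp [hj, hjp.1]) hjp.2

theorem GreedyRun.sum_le {B : ℝ} (hB : 0 ≤ B)
    (h : GreedyRun c gain (fun spent => B ≤ spent) I R s l) (hI : ∀ i ∈ I, c i ≤ B) (hs : 0 ≤ s) :
    (l.map c).sum ≤ 2 * B := by
  rcases List.eq_nil_or_concat l with rfl | ⟨pre, k, rfl⟩
  · simpa using hB
  · obtain ⟨h1, h2, -⟩ := h.split (pre := pre) (k := k) (post := []) (by simp)
    have := hI k h2
    simp only [not_le] at h1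
    simp
    linarith

/-- The halting condition is only ever evaluated at `s` plus a subset sum of the available costs.
This makes the loop, as a function of the budget, piecewise constant. -/
theorem greedyLoop_congr_halt {tie : Finset (Fin n) → Fin n} {halt' : ℝ → Prop}
    (I R : Finset (Fin n)) (s : ℝ)
    (h : ∀ J ⊆ I, (halt (s + ∑ i ∈ J, c i) ↔ halt' (s + ∑ i ∈ J, c i))) :
    greedyLoop c gain tie halt I R s = greedyLoop c gain tie halt' I R s := by
  induction hk : I.card using Nat.strong_induction_on generalizing I R s with
  | _ k ih =>
    conv_lhs => rw [greedyLoop]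
    conv_rhs => rw [greedyLoop]
    have h0 : halt s ↔ halt' s := by simpa using h ∅ (by simp)
    by_cases hc : ¬ halt s ∧ tie (bestItems c (gain R) I) ∈ I
    · rw [dif_pos hc, dif_pos (by rwa [← h0])]
      congr 1
      refine ih _ ?_ _ _ _ (fun J hJ => ?_) rfl
      · rw [← hk]
        exact Finset.card_erase_lt_of_mem hc.2
      · have hn : tie (bestItems c (gain R) I) ∉ J := fun hm => by simpa using hJ hm
        have := h (insert (tie (bestItems c (gain R) I)) J)
          (Finset.insert_subset hc.2 (hJ.trans (Finset.erase_subset _ _)))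
        rwa [Finset.sum_insert hn, ← add_assoc] at this
    · rw [dif_neg hc, dif_neg (by rwa [← h0])]

end Greedy

/-! ### Submodular set functions -/

/-- `f` is normalized, monotone and submodular on the subsets of `N`. -/
structure IsSubmodularOn {n : ℕ} (N : Finset (Fin n)) (f : Finset (Fin n) → ℝ) : Prop where
  empty : f ∅ = 0
  mono : ∀ R R', R ⊆ R' → R' ⊆ N → f R ≤ f R'
  diminish : ∀ R R' i, R ⊆ R' → R' ⊆ N → i ∈ N → i ∉ R' →
    f (insert i R') - f R' ≤ f (insert i R) - f R

section SetFunction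

variable {n : ℕ} {c : Fin n → ℝ} {N : Finset (Fin n)} {f : Finset (Fin n) → ℝ}

theorem IsSubmodularOn.nonneg (hf : IsSubmodularOn N f) {R : Finset (Fin n)} (hR : R ⊆ N) :
    0 ≤ f R := by
  simpa [hf.empty] using hf.mono ∅ R (by simp) hR

theorem IsSubmodularOn.insert_le (hf : IsSubmodularOn N f) {R : Finset (Fin n)} (hR : R ⊆ N)
    {i : Fin n} (hi : i ∈ N) : f (insert i R) ≤ f {i} + f R := by
  by_cases h : i ∈ R
  · rw [Finset.insert_eq_of_mem h]
    linarith [hf.nonneg (R := {i}) (by simpa using hi)]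
  · have := hf.diminish ∅ R i (by simp) hR hi h
    simp only [hf.empty, insert_empty_eq] at this
    linarith

theorem IsSubmodularOn.union_sub_le (hf : IsSubmodularOn N f) {R : Finset (Fin n)} (hR : R ⊆ N)
    (V : Finset (Fin n)) (hV : V ⊆ N) :
    f (R ∪ V) - f R ≤ ∑ i ∈ V, (f (insert i R) - f R) := by
  induction V using Finset.induction_on with
  | empty => simp
  | insert j V hj ih =>
    rw [Finset.insert_subset_iff] at hV
    rw [Finset.sum_insert hj, Finset.union_insert]
    have ih := ih hV.2
    by_cases hm : j ∈ R ∪ V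
    · rw [Finset.insert_eq_of_mem hm]
      have := hf.mono R (insert j R) (Finset.subset_insert _ _) (Finset.insert_subset hV.1 hR)
      linarith
    · have := hf.diminish R (R ∪ V) j Finset.subset_union_left (Finset.union_subset hR hV.2)
        hV.1 hm
      linarith

/-- A greedy step gains at least the average density of any competing set of items. -/
theorem IsSubmodularOn.greedy_step (hf : IsSubmodularOn N f) (hc : ∀ i, 0 < c i)
    {R V I : Finset (Fin n)} (hR : R ⊆ N) (hV : V ⊆ N) (hVI : V \ R ⊆ I) {k : Fin n}
    (hkN : k ∈ N) {β : ℝ} (hβ : ∑ i ∈ V, c i ≤ β)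
    (hmax : ∀ j ∈ I, (f (insert j R) - f R) / c j ≤ (f (insert k R) - f R) / c k) :
    c k * (f V - f R) ≤ β * (f (insert k R) - f R) := by
  have hk : 0 ≤ f (insert k R) - f R :=
    sub_nonneg.2 (hf.mono _ _ (Finset.subset_insert _ _) (Finset.insert_subset hkN hR))
  have h1 : f V - f R ≤ ∑ i ∈ V, c i * ((f (insert k R) - f R) / c k) := by
    calc f V - f R ≤ f (R ∪ V) - f R := by
          linarith [hf.mono V (R ∪ V) Finset.subset_union_right (Finset.union_subset hR hV)]
      _ ≤ _ := hf.union_sub_le hR V hV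
      _ ≤ _ := by
        refine Finset.sum_le_sum fun i hi => ?_
        by_cases hiR : i ∈ R
        · rw [Finset.insert_eq_of_mem hiR, sub_self]
          exact mul_nonneg (hc i).le (div_nonneg hk (hc k).le)
        · have := hmax i (hVI (Finset.mem_sdiff.2 ⟨hi, hiR⟩))
          rw [div_le_iff₀ (hc i)] at this
          linarith
  rw [← Finset.sum_mul] at h1
  have h2 : f V - f R ≤ β * ((f (insert k R) - f R) / c k) :=
    h1.trans (mul_le_mul_of_nonneg_right hβ (div_nonneg hk (hc k).le))
  calc c k * (f V - f R) ≤ c k * (β * ((f (insert k R) - f R) / c k)) :=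
        mul_le_mul_of_nonneg_left h2 (hc k).le
    _ = β * (f (insert k R) - f R) := by
        have := (hc k).ne'
        field_simp

theorem IsSubmodularOn.greedyRun_step (hf : IsSubmodularOn N f) (hc : ∀ i, 0 < c i)
    {halt : ℝ → Prop} {R V I : Finset (Fin n)} {s : ℝ} {l pre post : List (Fin n)} {k : Fin n}
    (h : GreedyRun c (fun R i => f (insert i R) - f R) halt I R s l) (hl : l = pre ++ k :: post)
    (hI : I ⊆ N) (hR : R ⊆ N) (hV : V ⊆ N) (hVI : V \ R ⊆ I) {β : ℝ} (hβ : ∑ i ∈ V, c i ≤ β) :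
    c k * (f V - f (R ∪ pre.toFinset)) ≤
      β * (f (insert k (R ∪ pre.toFinset)) - f (R ∪ pre.toFinset)) := by
  obtain ⟨-, hk, hmax⟩ := h.split hl
  have hpre : pre.toFinset ⊆ N := fun i hi =>
    hI (h.mem i (by rw [hl]; simp [List.mem_toFinset.1 hi]))
  refine hf.greedy_step hc (Finset.union_subset hR hpre) hV (I := I \ pre.toFinset) ?_ (hI hk) hβ ?_
  · intro i hi
    simp only [Finset.mem_sdiff, Finset.mem_union, not_or] at hi ⊢
    exact ⟨hVI (by simp [hi.1, hi.2.1]), hi.2.2⟩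
  · intro j hj
    simp only [Finset.mem_sdiff, List.mem_toFinset] at hj
    exact hmax j hj.1 hj.2

/-- Choosing `k` closes at least the fraction `c k / β` of the remaining deficit relative to `f V`,
and `1 - x ≤ e^{-x}` turns the product of the factors into one exponential. The set `R` lets the run
start from items that were chosen earlier. -/
theorem IsSubmodularOn.greedyRun_exp (hf : IsSubmodularOn N f) (hc : ∀ i, 0 < c i)
    {halt : ℝ → Prop} {R V I : Finset (Fin n)} {s : ℝ} {l : List (Fin n)}
    (h : GreedyRun c (fun R i => f (insert i R) - f R) halt I R s l)
    (hI : I ⊆ N) (hR : R ⊆ N) (hV : V ⊆ N) (hVI : V \ R ⊆ I) {β : ℝ} (hβ0 : 0 < β)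
    (hβ : ∑ i ∈ V, c i ≤ β) (pre post : List (Fin n)) (hl : l = pre ++ post) :
    f V - f (R ∪ pre.toFinset) ≤ Real.exp (-((pre.map c).sum / β)) * f V := by
  induction pre using List.reverseRecOn generalizing post with
  | nil => simp [hf.nonneg hR]
  | append_singleton pre k ih =>
    have hl' : l = pre ++ k :: post := by simp [hl]
    have h1 := hf.greedyRun_step hc h hl' hI hR hV hVI hβ
    have h2 := ih (k :: post) hl'
    have hpre : R ∪ pre.toFinset ⊆ N := Finset.union_subset hR fun i hi =>
      hI (h.mem i (by rw [hl']; simp [List.mem_toFinset.1 hi]))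
    have h3 := hf.mono _ _ (Finset.subset_insert k (R ∪ pre.toFinset))
      (Finset.insert_subset (hI (h.split hl').2.1) hpre)
    have hset : R ∪ (pre ++ [k]).toFinset = insert k (R ∪ pre.toFinset) := by
      ext j; simp
    rw [hset]
    set F := f (R ∪ pre.toFinset)
    set F' := f (insert k (R ∪ pre.toFinset))
    have hexp : Real.exp (-(((pre ++ [k]).map c).sum / β)) =
        Real.exp (-(c k / β)) * Real.exp (-((pre.map c).sum / β)) := by
      rw [← Real.exp_add]
      congr 1
      simp
      ring
    rw [hexp, mul_assoc]
    -- Multiplying `1 - x ≤ e^{-x}` by the deficit needs a nonnegative deficit. Otherwise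
    -- monotonicity suffices, as the right side is nonnegative.
    by_cases hF : f V - F ≤ 0
    · have : 0 ≤ Real.exp (-(c k / β)) * (Real.exp (-((pre.map c).sum / β)) * f V) :=
        mul_nonneg (Real.exp_nonneg _) (mul_nonneg (Real.exp_nonneg _) (hf.nonneg hV))
      linarith
    · push Not at hF
      have h4 : c k / β * (f V - F) ≤ F' - F := by
        rw [div_mul_eq_mul_div, div_le_iff₀ hβ0]
        linarith
      have h5 : 1 - c k / β ≤ Real.exp (-(c k / β)) := by
        linarith [Real.add_one_le_exp (-(c k / β))]
      calc f V - F' ≤ (1 - c k / β) * (f V - F) := by linarith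
        _ ≤ Real.exp (-(c k / β)) * (f V - F) := mul_le_mul_of_nonneg_right h5 hF.le
        _ ≤ _ := mul_le_mul_of_nonneg_left h2 (Real.exp_nonneg _)

/-! ### Wolsey's algorithm and the budget -/

theorem exp_chi : Real.exp chi = 2 - chi := Classical.choose_spec exists_chi

theorem chi_nonneg : 0 ≤ chi := by
  by_contra! h
  have := Real.exp_lt_one_iff.2 h
  linarith [exp_chi]

theorem chi_lt_one : chi < 1 := by
  linarith [exp_chi, Real.add_one_le_exp chi, Real.exp_pos chi,
    Real.one_le_exp chi_nonneg, show chi ≠ 1 from fun h => by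
      have := exp_chi; rw [h] at this; linarith [Real.add_one_le_exp (1 : ℝ)]]

/-- The reason for the choice of `χ`: it makes the guarantees of the two candidates in Wolsey's
algorithm, `1 - e^{-χ}` for the prefix and `(1 - χ) e^{-χ}` for the last item, equal. -/
theorem one_sub_chi_mul : (1 - chi) * Real.exp (-chi) = alpha := by
  have : Real.exp chi * Real.exp (-chi) = 1 := by rw [← Real.exp_add]; simp
  rw [exp_chi] at this
  rw [alpha]
  linarith

theorem alpha_pos : 0 < alpha := by
  rw [← one_sub_chi_mul]
  exact mul_pos (by linarith [chi_lt_one]) (Real.exp_pos _)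

theorem alpha_le_half : alpha ≤ 1 / 2 := by
  have h := one_sub_chi_mul
  have h2 := Real.exp_pos (-chi)
  rw [alpha] at h ⊢
  nlinarith [chi_nonneg]

theorem wolseyGreedy_cases {tie : Finset (Fin n) → Fin n} (htie : IsTieRule tie)
    (f : Finset (Fin n) → ℝ) (B : ℝ) :
    ∃ l, GreedyRun c (fun R i => f (insert i R) - f R) (fun spent => B < spent)
        (N.filter (fun i => c i ≤ B)) ∅ 0 l ∧
      (l = [] ∧ wolseyGreedy c tie N f B = ∅ ∨ ∃ pre k, l = pre ++ [k] ∧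
        (wolseyGreedy c tie N f B = {k} ∧ f pre.toFinset ≤ f {k} ∨
          wolseyGreedy c tie N f B = pre.toFinset ∧ f {k} ≤ f pre.toFinset)) := by
  have hrun := greedyLoop_run (c := c) (gain := fun R i => f (insert i R) - f R)
    (halt := fun spent => B < spent) htie (N.filter (fun i => c i ≤ B)) ∅ 0
  refine ⟨_, hrun, ?_⟩
  rw [wolseyGreedy]
  generalize greedyLoop c (fun R i => f (insert i R) - f R) tie (fun spent => B < spent)
    (N.filter (fun i => c i ≤ B)) ∅ 0 = l at hrun
  rcases List.eq_nil_or_concat l with rfl | ⟨pre, k, rfl⟩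
  · simp
  · right
    refine ⟨pre, k, by simp, ?_⟩
    have hk : k ∉ pre := by
      have := hrun.nodup
      simp only [List.concat_eq_append, List.nodup_append] at this
      exact fun h => this.2.2 k h k (by simp) rfl
    have hset : (pre ++ [k]).toFinset.erase k = pre.toFinset := by
      ext j
      simp only [Finset.mem_erase, List.mem_toFinset, List.mem_append, List.mem_singleton]
      constructor
      · rintro ⟨h1, h2 | h2⟩ <;> tauto
      · intro h
        exact ⟨fun e => hk (e ▸ h), Or.inl h⟩
    simp only [List.concat_eq_append, List.getLast?_append, List.getLast?_singleton,
      Option.some_or, hset]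
    split_ifs with h
    · exact Or.inl ⟨rfl, h⟩
    · exact Or.inr ⟨rfl, (not_le.1 h).le⟩

theorem wolseyGreedy_feasible {tie : Finset (Fin n) → Fin n}
    (htie : IsTieRule tie) (N : Finset (Fin n)) (f : Finset (Fin n) → ℝ) {B : ℝ} (hB : 0 ≤ B) :
    wolseyGreedy c tie N f B ⊆ N.filter (fun i => c i ≤ B) ∧
      ∑ i ∈ wolseyGreedy c tie N f B, c i ≤ B := by
  obtain ⟨l, hrun, ⟨-, h⟩ | ⟨pre, k, hl, h⟩⟩ := wolseyGreedy_cases (c := c) (N := N) htie f B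
  · simp [h, hB]
  · obtain ⟨h1, h2, -⟩ := hrun.split (pre := pre) (k := k) (post := []) hl
    rcases h with ⟨h, -⟩ | ⟨h, -⟩
    · simp only [Finset.mem_filter] at h2
      simp [h, h2]
    · rw [h]
      refine ⟨fun i hi => hrun.mem i (by simp [hl, List.mem_toFinset.1 hi]), ?_⟩
      have hnd : pre.Nodup := by
        have := hrun.nodup
        rw [hl, List.nodup_append] at this
        exact this.1
      rw [List.sum_toFinset _ hnd]
      simpa using h1

/-- Wolsey's guarantee: with enough budget for a set that attains the full utility, the algorithm
attains the fraction `α` of it. -/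
theorem IsSubmodularOn.alpha_le_wolseyGreedy (hf : IsSubmodularOn N f) (hc : ∀ i, 0 < c i)
    {tie : Finset (Fin n) → Fin n} (htie : IsTieRule tie) {V : Finset (Fin n)} (hV : V ⊆ N)
    (hfV : f V = f N) :
    alpha * f N ≤ f (wolseyGreedy c tie N f (∑ i ∈ V, c i)) := by
  set B := ∑ i ∈ V, c i with hBdef
  have hB0 : 0 ≤ B := Finset.sum_nonneg fun i _ => (hc i).le
  have hfeas := (wolseyGreedy_feasible (c := c) htie N f hB0).1
  rcases eq_or_lt_of_le (hf.nonneg (R := N) subset_rfl) with h0 | h0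
  · rw [← h0, mul_zero]
    exact hf.nonneg (hfeas.trans (Finset.filter_subset _ _))
  have hVne : V.Nonempty := by
    rw [Finset.nonempty_iff_ne_empty]
    rintro rfl
    rw [hf.empty] at hfV
    exact h0.ne hfV
  have hBpos : 0 < B := Finset.sum_pos (fun i _ => hc i) hVne
  have hVI : V ⊆ N.filter (fun i => c i ≤ B) := fun i hi =>
    Finset.mem_filter.2 ⟨hV hi, Finset.single_le_sum (fun j _ => (hc j).le) hi⟩
  obtain ⟨l, hrun, ⟨rfl, -⟩ | ⟨pre, k, hl, h⟩⟩ := wolseyGreedy_cases (c := c) (N := N) htie f B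
  · exfalso
    rcases hrun.halt_or_exhausted with h | h
    · simp at h
      linarith
    · obtain ⟨i, hi⟩ := hVne
      simpa using h i (hVI hi)
  have hmax : f pre.toFinset ≤ f (wolseyGreedy c tie N f B) ∧
      f {k} ≤ f (wolseyGreedy c tie N f B) := by
    rcases h with ⟨h, h'⟩ | ⟨h, h'⟩ <;> rw [h] <;> simp [h']
  generalize f (wolseyGreedy c tie N f B) = v at hmax
  have hIN : N.filter (fun i => c i ≤ B) ⊆ N := Finset.filter_subset _ _
  have hkN : k ∈ N := hIN (hrun.mem k (by simp [hl]))
  have hpre : pre.toFinset ⊆ N := fun i hi =>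
    hIN (hrun.mem i (by simp [hl, List.mem_toFinset.1 hi]))
  have hins := hf.insert_le hpre hkN
  rcases hrun.halt_or_exhausted with hh | hh
  · have h1 := hf.greedyRun_exp hc hrun hIN (by simp) hV
      (Finset.sdiff_subset.trans hVI) hBpos le_rfl pre [k] hl
    have h2 := hf.greedyRun_step hc hrun (post := []) hl hIN (by simp) hV
      (Finset.sdiff_subset.trans hVI) (β := B) le_rfl
    simp only [Finset.empty_union, hfV] at h1 h2
    set F := f pre.toFinset
    set y := (pre.map c).sum / B with hy
    have hh' : 1 - y < c k / B := by
      rw [hy, lt_div_iff₀ hBpos, sub_mul, div_mul_cancel₀ _ hBpos.ne']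
      simp [hl] at hh
      linarith
    have h3 : c k / B * (f N - F) ≤ f {k} := by
      rw [div_mul_eq_mul_div, div_le_iff₀ hBpos]
      have := mul_le_mul_of_nonneg_left (sub_le_iff_le_add.2 hins) hBpos.le
      linarith
    by_cases hα : alpha * f N ≤ F
    · linarith
    · push Not at hα
      rw [alpha] at hα
      -- A prefix that spends the fraction `χ` of the budget attains `α` by itself. Otherwise the
      -- last item overshoots the budget, so it costs more than `(1 - χ) B` and closes more than
      -- that fraction of a deficit exceeding `e^{-χ} f N`.
      have h4 : y < chi := by
        by_contra! hχ
        have : Real.exp (-y) ≤ Real.exp (-chi) := Real.exp_le_exp.2 (by linarith)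
        have := mul_le_mul_of_nonneg_right this h0.le
        linarith
      have h5 : Real.exp (-chi) * f N < f N - F := by linarith
      have h6 := chi_lt_one
      rw [← one_sub_chi_mul]
      have h7 : 0 < Real.exp (-chi) * f N := mul_pos (Real.exp_pos _) h0
      have h8 : (1 - chi) * (Real.exp (-chi) * f N) ≤ c k / B * (f N - F) :=
        mul_le_mul (by linarith) h5.le h7.le (div_nonneg (hc k).le hBpos.le)
      linarith
  -- No affordable item is left, so the prefix and the last item together attain `f N`. The better
  -- of the two attains half of it, and `α ≤ 1/2`.
  · have h1 : V ⊆ insert k pre.toFinset := fun i hi => by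
      have := hh i (hVI hi)
      rw [hl] at this
      simpa [or_comm] using this
    have h2 := hf.mono _ _ h1 (Finset.insert_subset hkN hpre)
    have h3 : alpha * f N ≤ 1 / 2 * f N := mul_le_mul_of_nonneg_right alpha_le_half h0.le
    linarith

/-- The largest subset sum below a budget is an equivalent budget. -/
theorem exists_subset_sum_budget (tie : Finset (Fin n) → Fin n)
    (N : Finset (Fin n)) (f : Finset (Fin n) → ℝ) {B : ℝ} (hB : 0 ≤ B) :
    ∃ J ⊆ N, ∑ i ∈ J, c i ≤ B ∧
      wolseyGreedy c tie N f (∑ i ∈ J, c i) = wolseyGreedy c tie N f B := by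
  classical
  obtain ⟨J, hJ, hmax⟩ := (N.powerset.filter (fun J => ∑ i ∈ J, c i ≤ B)).exists_max_image
    (fun J => ∑ i ∈ J, c i) ⟨∅, by simp [hB]⟩
  simp only [Finset.mem_filter, Finset.mem_powerset] at hJ hmax
  refine ⟨J, hJ.1, hJ.2, ?_⟩
  have key : ∀ J' ⊆ N, (∑ i ∈ J', c i ≤ ∑ i ∈ J, c i ↔ ∑ i ∈ J', c i ≤ B) := fun J' hJ' =>
    ⟨fun h => h.trans hJ.2, fun h => hmax J' ⟨hJ', h⟩⟩
  have hfilter : N.filter (fun i => c i ≤ ∑ i ∈ J, c i) = N.filter (fun i => c i ≤ B) := by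
    refine Finset.filter_congr fun i hi => ?_
    simpa using key {i} (by simpa using hi)
  unfold wolseyGreedy
  rw [hfilter, greedyLoop_congr_halt (halt' := fun spent => B < spent)]
  intro J' hJ'
  rw [zero_add, ← not_le, ← not_le, key J' (hJ'.trans (Finset.filter_subset _ _))]

/-- Any budget can be lowered to a subset sum without changing the output, so the minimum may be
taken over finitely many subset sums. The sum over all of `N` is admissible by Wolsey's guarantee.
-/
theorem IsSubmodularOn.exists_isBudget (hf : IsSubmodularOn N f) (hc : ∀ i, 0 < c i)
    {tie : Finset (Fin n) → Fin n} (htie : IsTieRule tie) : ∃ B, IsBudget c tie N f B := by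
  classical
  obtain ⟨J, hJ, hmin⟩ := (N.powerset.filter (fun J =>
      alpha * f N ≤ f (wolseyGreedy c tie N f (∑ i ∈ J, c i)))).exists_min_image
    (fun J => ∑ i ∈ J, c i) ⟨N, by simp [hf.alpha_le_wolseyGreedy hc htie subset_rfl rfl]⟩
  simp only [Finset.mem_filter, Finset.mem_powerset] at hJ hmin
  refine ⟨∑ i ∈ J, c i, ⟨Finset.sum_nonneg fun i _ => (hc i).le,
    Finset.sum_le_sum_of_subset_of_nonneg hJ.1 fun i _ _ => (hc i).le, hJ.2⟩, ?_⟩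
  rintro B ⟨h0, -, hB⟩
  obtain ⟨J', hJ', hle, heq⟩ := exists_subset_sum_budget tie N f h0
  exact (hmin J' ⟨hJ', heq ▸ hB⟩).trans hle

/-- By minimality `B` does not exceed the equivalent subset sum below it, and the items of that
subset each cost at most `B`. Hence the first stage cannot run out of items before spending `B`. -/
theorem IsBudget.le_sum_filter (hc : ∀ i, 0 < c i) {tie : Finset (Fin n) → Fin n} {B : ℝ}
    (hB : IsBudget c tie N f B) : B ≤ ∑ i ∈ N.filter (fun i => c i ≤ B), c i := by
  obtain ⟨J, hJ, hle, heq⟩ := exists_subset_sum_budget tie N f hB.1.1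
  have h : B ≤ ∑ i ∈ J, c i := hB.2 ⟨Finset.sum_nonneg fun i _ => (hc i).le,
    hle.trans hB.1.2.1, heq ▸ hB.1.2.2⟩
  refine h.trans (Finset.sum_le_sum_of_subset_of_nonneg (fun i hi => ?_) fun i _ _ => (hc i).le)
  exact Finset.mem_filter.2
    ⟨hJ hi, (Finset.single_le_sum (fun j _ => (hc j).le) hi).trans hle⟩

theorem IsSubmodularOn.budget_le (hf : IsSubmodularOn N f) (hc : ∀ i, 0 < c i)
    {tie : Finset (Fin n) → Fin n} (htie : IsTieRule tie) {B : ℝ} (hB : IsBudget c tie N f B)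
    {V : Finset (Fin n)} (hV : V ⊆ N) (hfV : f V = f N) : B ≤ ∑ i ∈ V, c i :=
  hB.2 ⟨Finset.sum_nonneg fun i _ => (hc i).le,
    Finset.sum_le_sum_of_subset_of_nonneg hV fun i _ _ => (hc i).le,
    hf.alpha_le_wolseyGreedy hc htie hV hfV⟩

theorem IsSubmodularOn.budget_pos (hf : IsSubmodularOn N f) (hc : ∀ i, 0 < c i)
    {tie : Finset (Fin n) → Fin n} (htie : IsTieRule tie) {B : ℝ} (hB : IsBudget c tie N f B)
    (hN : 0 < f N) : 0 < B := by
  refine lt_of_le_of_ne hB.1.1 fun h => ?_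
  have h1 := (wolseyGreedy_feasible (c := c) htie N f hB.1.1).1
  have h2 : wolseyGreedy c tie N f B = ∅ := by
    refine Finset.subset_empty.1 fun i hi => ?_
    have := (Finset.mem_filter.1 (h1 hi)).2
    linarith [hc i]
  have h3 := hB.1.2.2
  rw [h2, hf.empty] at h3
  linarith [mul_pos alpha_pos hN]

/-- Greedily spending the budget attains a constant fraction of the full utility. -/
theorem IsSubmodularOn.greedyRun_budget (hf : IsSubmodularOn N f) (hc : ∀ i, 0 < c i)
    {tie : Finset (Fin n) → Fin n} (htie : IsTieRule tie) {B : ℝ} (hB : IsBudget c tie N f B)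
    (hN : 0 < f N) {R : Finset (Fin n)} (hR : R ⊆ N) {l : List (Fin n)}
    (h : GreedyRun c (fun R i => f (insert i R) - f R) (fun spent => B ≤ spent)
      (N.filter (fun i => c i ≤ B) \ R) R 0 l) :
    alpha / 2 * f N ≤ f (R ∪ l.toFinset) := by
  have hBpos := hf.budget_pos hc htie hB hN
  have hZ := wolseyGreedy_feasible (c := c) htie N f hB.1.1
  have hα := hB.1.2.2
  set Z := wolseyGreedy c tie N f B
  have hZN : Z ⊆ N := hZ.1.trans (Finset.filter_subset _ _)
  have hIN : N.filter (fun i => c i ≤ B) \ R ⊆ N :=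
    Finset.sdiff_subset.trans (Finset.filter_subset _ _)
  have hZ0 := hf.nonneg hZN
  rcases h.halt_or_exhausted with hh | hh
  -- The comparison is with Wolsey's set `Z`, which fits into `B`; a set attaining `f N` need not.
  -- Spending `B` leaves at most `e^{-1} ≤ 1/2` of `f Z`, and `f Z ≥ α f N`.
  · have h1 := hf.greedyRun_exp hc h hIN hR hZN
      (Finset.sdiff_subset_sdiff hZ.1 subset_rfl) hBpos hZ.2 l [] (by simp)
    have h2 : Real.exp (-((l.map c).sum / B)) ≤ 1 / 2 := by
      have h3 : (1 : ℝ) ≤ (l.map c).sum / B := by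
        rw [le_div_iff₀ hBpos]
        linarith
      rw [Real.exp_neg, one_div]
      exact inv_anti₀ (by norm_num) (by linarith [Real.add_one_le_exp ((l.map c).sum / B)])
    have h4 := mul_le_mul_of_nonneg_right h2 hZ0
    linarith
  · have h1 : Z ⊆ R ∪ l.toFinset := fun i hi => by
      by_cases hiR : i ∈ R
      · simp [hiR]
      · simp [hh i (Finset.mem_sdiff.2 ⟨hZ.1 hi, hiR⟩)]
    have h2 := hf.mono _ _ h1 (Finset.union_subset hR fun i hi =>
      hIN (h.mem i (List.mem_toFinset.1 hi)))
    linarith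

end SetFunction

/-! ### Cost up to the first departure from the assumed states -/

open scoped Classical in
/-- The cost, on the realization `a`, of the items of the list up to and including the first one
whose state differs from the one given by `σ`. -/
noncomputable def exitCost {n : ℕ} {Γ : Type u} (c : Fin n → ℝ) (σ : Fin n → Γ) :
    List (Fin n) → (Fin n → Γ) → ℝ
  | [], _ => 0
  | i :: l, a => c i + if a i = σ i then exitCost c σ l a else 0

section ExitCost

variable {n : ℕ} {Γ : Type u} {c : Fin n → ℝ} {σ : Fin n → Γ}

theorem exitCost_nonneg (hc : ∀ i, 0 < c i) (l : List (Fin n)) (a : Fin n → Γ) :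
    0 ≤ exitCost c σ l a := by
  induction l with
  | nil => simp [exitCost]
  | cons i l ih =>
    rw [exitCost]
    split_ifs <;> linarith [hc i]

theorem exitCost_le_sum (hc : ∀ i, 0 < c i) (l : List (Fin n)) (a : Fin n → Γ) :
    exitCost c σ l a ≤ (l.map c).sum := by
  induction l with
  | nil => simp [exitCost]
  | cons i l ih =>
    have := exitCost_nonneg (σ := σ) hc l a
    rw [exitCost]
    simp only [List.map_cons, List.sum_cons]
    split_ifs <;> linarith

/-- A realization that departs within `l₁` pays nothing for `l₂`. Any other has paid for all of
`l₁`, at least `B`, and pays at most `2 * B` more. -/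
theorem exitCost_append_le (hc : ∀ i, 0 < c i) {B : ℝ} {l₁ l₂ : List (Fin n)}
    (h₁ : B ≤ (l₁.map c).sum) (h₂ : (l₂.map c).sum ≤ 2 * B) (a : Fin n → Γ) :
    exitCost c σ (l₁ ++ l₂) a ≤ 3 * exitCost c σ l₁ a := by
  have key : exitCost c σ (l₁ ++ l₂) a = exitCost c σ l₁ a ∨
      exitCost c σ l₁ a = (l₁.map c).sum ∧
        exitCost c σ (l₁ ++ l₂) a = (l₁.map c).sum + exitCost c σ l₂ a := by
    clear h₁
    induction l₁ with
    | nil => simp [exitCost]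
    | cons i l ih =>
      simp only [List.cons_append, exitCost, List.map_cons, List.sum_cons]
      split_ifs with h
      · rcases ih with h | ⟨h, h'⟩
        · simp [h]
        · right
          rw [h, h']
          exact ⟨rfl, by ring⟩
      · simp
  have h0 := exitCost_nonneg (σ := σ) hc l₁ a
  rcases key with h | ⟨h, h'⟩
  · linarith
  · linarith [exitCost_le_sum (σ := σ) hc l₂ a]

/-- The part of a list that fits into the budget `s` is where every realization of exit cost at
most `s` departs. -/
theorem exists_sublist_exit (hc : ∀ i, 0 < c i) (σ : Fin n → Γ) (U : List (Fin n)) {s : ℝ}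
    (hs : 0 ≤ s) (hU : s < (U.map c).sum) :
    ∃ V : List (Fin n), (∀ i ∈ V, i ∈ U ∧ c i ≤ s) ∧ (V.map c).sum ≤ s ∧
      ∀ a, exitCost c σ U a ≤ s → ∃ i ∈ V, a i ≠ σ i := by
  induction U generalizing s with
  -- `hU` is what excludes a realization that follows `σ` through the whole list and still has exit
  -- cost at most `s`.
  | nil => simp at hU; linarith
  | cons i U ih =>
    by_cases hi : c i ≤ s
    · simp only [List.map_cons, List.sum_cons] at hU
      obtain ⟨V, h1, h2, h3⟩ := ih (s := s - c i) (by linarith) (by linarith)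
      refine ⟨i :: V, ?_, by simp; linarith, fun a ha => ?_⟩
      · intro j hj
        rcases List.mem_cons.1 hj with rfl | hj
        · simp [hi]
        · have := h1 j hj
          exact ⟨by simp [this.1], by linarith [this.2, hc i]⟩
      · by_cases hai : a i = σ i
        · rw [exitCost, if_pos hai] at ha
          obtain ⟨j, hj, hne⟩ := h3 a (by linarith)
          exact ⟨j, by simp [hj], hne⟩
        · exact ⟨i, by simp, hai⟩
    · refine ⟨[], by simp, by simpa using hs, fun a ha => ?_⟩
      have := exitCost_nonneg (σ := σ) hc U a
      rw [exitCost] at ha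
      split_ifs at ha <;> linarith

theorem sum_toFinset_le (hc : ∀ i, 0 < c i) (l : List (Fin n)) :
    ∑ i ∈ l.toFinset, c i ≤ (l.map c).sum := by
  induction l with
  | nil => simp
  | cons i l ih =>
    rw [List.toFinset_cons, List.map_cons, List.sum_cons]
    by_cases h : i ∈ l.toFinset
    · rw [Finset.insert_eq_of_mem h]
      linarith [hc i]
    · rw [Finset.sum_insert h]
      linarith

end ExitCost

/-! ### Greedy removal of weight -/

open scoped Classical in
/-- The total weight of the elements of `E` that agree with `σ` on `R`. -/
noncomputable def survivingWeight {n : ℕ} {Γ : Type u} (E : Finset (Fin n → Γ))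
    (wt : (Fin n → Γ) → ℝ) (σ : Fin n → Γ) (R : Finset (Fin n)) : ℝ :=
  ∑ a ∈ E.filter (fun a => ∀ i ∈ R, a i = σ i), wt a

section Removal

open scoped Classical

variable {n : ℕ} {Γ : Type u} {c : Fin n → ℝ} {σ : Fin n → Γ} {E : Finset (Fin n → Γ)}
  {wt : (Fin n → Γ) → ℝ}

theorem survivingWeight_anti (hwt : ∀ a, 0 ≤ wt a) {R R' : Finset (Fin n)} (h : R ⊆ R') :
    survivingWeight E wt σ R' ≤ survivingWeight E wt σ R := by
  refine Finset.sum_le_sum_of_subset_of_nonneg (fun a ha => ?_) fun a _ _ => hwt a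
  rw [Finset.mem_filter] at ha ⊢
  exact ⟨ha.1, fun i hi => ha.2 i (h hi)⟩

theorem survivingWeight_sub_insert (R : Finset (Fin n)) (i : Fin n) :
    survivingWeight E wt σ R - survivingWeight E wt σ (insert i R) =
      ∑ a ∈ E.filter (fun a => (∀ i ∈ R, a i = σ i) ∧ a i ≠ σ i), wt a := by
  rw [sub_eq_iff_eq_add, survivingWeight, survivingWeight, Finset.sum_filter, Finset.sum_filter,
    Finset.sum_filter, ← Finset.sum_add_distrib]
  refine Finset.sum_congr rfl fun a _ => ?_
  simp only [Finset.forall_mem_insert]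
  by_cases h1 : ∀ i ∈ R, a i = σ i <;> by_cases h2 : a i = σ i <;> simp [h1, h2]

/-- A union bound over the items of `V`. -/
theorem sum_departing_le (hwt : ∀ a, 0 ≤ wt a) (R : Finset (Fin n)) (V : List (Fin n)) :
    ∑ a ∈ E.filter (fun a => (∀ i ∈ R, a i = σ i) ∧ ∃ i ∈ V, a i ≠ σ i), wt a ≤
      (V.map fun i => survivingWeight E wt σ R - survivingWeight E wt σ (insert i R)).sum := by
  induction V with
  | nil => simp
  | cons j V ih =>
    rw [List.map_cons, List.sum_cons]
    refine le_trans ?_ (add_le_add le_rfl ih)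
    rw [survivingWeight_sub_insert, Finset.sum_filter, Finset.sum_filter, Finset.sum_filter,
      ← Finset.sum_add_distrib]
    refine Finset.sum_le_sum fun a _ => ?_
    have := hwt a
    simp only [List.mem_cons, exists_eq_or_imp]
    split_ifs <;> grind

/-- A median-like threshold: weight at least `A / 2` lies at or above `s`, and at most `A / 2`
strictly above. Take the largest candidate with the first property. If the second failed, the next
larger value of `τ` would be a candidate too. -/
theorem exists_threshold {α : Type*} (E : Finset α) {wt : α → ℝ} (hwt : ∀ a, 0 ≤ wt a)
    (τ : α → ℝ) {A s₀ : ℝ} (hA : 0 ≤ A) (h₀ : A ≤ 2 * ∑ a ∈ E.filter (fun a => s₀ ≤ τ a), wt a) :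
    ∃ s, s₀ ≤ s ∧ (s = s₀ ∨ ∃ a ∈ E, s = τ a) ∧
      A ≤ 2 * ∑ a ∈ E.filter (fun a => s ≤ τ a), wt a ∧
      2 * ∑ a ∈ E.filter (fun a => s < τ a), wt a ≤ A := by
  obtain ⟨s, hs, hmax⟩ := ((insert s₀ (E.image τ)).filter (fun s => s₀ ≤ s ∧
    A ≤ 2 * ∑ a ∈ E.filter (fun a => s ≤ τ a), wt a)).exists_max_image id ⟨s₀, by simp [h₀]⟩
  simp only [Finset.mem_filter, Finset.mem_insert, Finset.mem_image, id] at hs hmax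
  refine ⟨s, hs.2.1, hs.1.imp id (fun ⟨a, ha, h⟩ => ⟨a, ha, h.symm⟩), hs.2.2, ?_⟩
  by_contra! hlt
  have hne : (E.filter (fun a => s < τ a)).Nonempty := by
    rw [Finset.nonempty_iff_ne_empty]
    intro h
    rw [h] at hlt
    simp at hlt
    linarith
  obtain ⟨a, ha, hmin⟩ := Finset.exists_min_image _ τ hne
  rw [Finset.mem_filter] at ha
  refine absurd (hmax (τ a) ⟨Or.inr ⟨a, ha.1, rfl⟩, hs.2.1.trans ha.2.le, ?_⟩) (not_le.2 ha.2)
  refine hlt.le.trans (mul_le_mul_of_nonneg_left ?_ (by norm_num))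
  refine Finset.sum_le_sum_of_subset_of_nonneg (fun x hx => ?_) fun x _ _ => hwt x
  exact Finset.mem_filter.2 ⟨(Finset.mem_filter.1 hx).1, hmin x hx⟩

/-- A greedy step compared with a competing sequence by which at least half of the surviving weight
departs at cost at most `s`. -/
theorem removal_step (hc : ∀ i, 0 < c i) (hwt : ∀ a, 0 ≤ wt a) {I R : Finset (Fin n)} {k : Fin n}
    (hmax : ∀ j ∈ I, (survivingWeight E wt σ R - survivingWeight E wt σ (insert j R)) / c j ≤
      (survivingWeight E wt σ R - survivingWeight E wt σ (insert k R)) / c k)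
    {U : List (Fin n)} {s B : ℝ} (hs : 0 ≤ s) (hsB : s < B) (hU : B ≤ (U.map c).sum)
    (hUI : ∀ i ∈ U, c i ≤ B → i ∈ R ∨ i ∈ I)
    (hhalf : 2 * ∑ a ∈ E.filter (fun a => s < min (exitCost c σ U a) B), wt a ≤
      survivingWeight E wt σ R) :
    c k * survivingWeight E wt σ R ≤
      2 * s * (survivingWeight E wt σ R - survivingWeight E wt σ (insert k R)) := by
  obtain ⟨V, hV, hVs, hexit⟩ := exists_sublist_exit hc σ U hs (hsB.trans_le hU)
  have h1 := sum_departing_le (E := E) (σ := σ) hwt R V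
  have hgain : ∀ i, 0 ≤ survivingWeight E wt σ R - survivingWeight E wt σ (insert i R) := fun i =>
    sub_nonneg.2 (survivingWeight_anti hwt (Finset.subset_insert _ _))
  have h2 : (V.map fun i => survivingWeight E wt σ R - survivingWeight E wt σ (insert i R)).sum ≤
      (V.map fun i => c i *
        ((survivingWeight E wt σ R - survivingWeight E wt σ (insert k R)) / c k)).sum := by
    refine List.sum_le_sum fun i hi => ?_
    by_cases hiR : i ∈ R
    · rw [Finset.insert_eq_of_mem hiR, sub_self]
      exact mul_nonneg (hc i).le (div_nonneg (hgain k) (hc k).le)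
    · have hiI := (hUI i (hV i hi).1 ((hV i hi).2.trans hsB.le)).resolve_left hiR
      have := hmax i hiI
      rw [div_le_iff₀ (hc i)] at this
      linarith
  rw [List.sum_map_mul_right] at h2
  have h3 : survivingWeight E wt σ R ≤
      ∑ a ∈ E.filter (fun a => (∀ i ∈ R, a i = σ i) ∧ ∃ i ∈ V, a i ≠ σ i), wt a +
      ∑ a ∈ E.filter (fun a => s < min (exitCost c σ U a) B), wt a := by
    rw [survivingWeight, Finset.sum_filter, Finset.sum_filter, Finset.sum_filter,
      ← Finset.sum_add_distrib]
    refine Finset.sum_le_sum fun a _ => ?_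
    have := hwt a
    by_cases h1 : ∀ i ∈ R, a i = σ i
    · by_cases h2 : s < min (exitCost c σ U a) B
      · rw [if_pos h1, if_pos h2]
        split_ifs <;> linarith
      · have h3 : ∃ i ∈ V, a i ≠ σ i := by
          refine hexit a ?_
          by_contra! h
          exact h2 (lt_min h hsB)
        rw [if_pos h1, if_pos ⟨h1, h3⟩, if_neg h2]
        linarith
    · rw [if_neg h1]
      split_ifs <;> linarith
  set D := (survivingWeight E wt σ R - survivingWeight E wt σ (insert k R)) / c k with hD
  have hD0 : 0 ≤ D := div_nonneg (hgain k) (hc k).le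
  have h4 : (V.map c).sum * D ≤ s * D := mul_le_mul_of_nonneg_right hVs hD0
  have h5 : survivingWeight E wt σ R - survivingWeight E wt σ (insert k R) = c k * D := by
    rw [hD]
    have := (hc k).ne'
    field_simp
  rw [h5]
  have h6 : survivingWeight E wt σ R ≤ 2 * s * D := by linarith
  linarith [mul_le_mul_of_nonneg_left h6 (hc k).le]

theorem sum_exitCost_cons (R : Finset (Fin n)) (k : Fin n) (l : List (Fin n)) :
    ∑ a ∈ E.filter (fun a => ∀ i ∈ R, a i = σ i), wt a * exitCost c σ (k :: l) a =
      c k * survivingWeight E wt σ R +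
      ∑ a ∈ E.filter (fun a => ∀ i ∈ insert k R, a i = σ i), wt a * exitCost c σ l a := by
  rw [survivingWeight, Finset.mul_sum, Finset.sum_filter, Finset.sum_filter, Finset.sum_filter,
    ← Finset.sum_add_distrib]
  refine Finset.sum_congr rfl fun a _ => ?_
  simp only [Finset.forall_mem_insert, exitCost]
  split_ifs <;> grind

/-- With `τ` the exit cost of `U` truncated at `B`, let `s` be the threshold beyond which at most
half of the surviving weight `A` has its `τ`. The part of `U` within cost `s` removes at least `A /
2`, so greedy removes weight at density at least `A / (2 s)`, and choosing `k` costs `c k * A ≤ 2 s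
(A - A')`, where `A'` is the weight surviving `k`. The bound is a potential for summing these
charges: `s₀` is the threshold reached so far, the second sum pays for its later increases, and the
third for the end of the run, once the threshold is `B`. -/
theorem GreedyRun.sum_exitCost_le_aux (hc : ∀ i, 0 < c i) (hwt : ∀ a, 0 ≤ wt a) {B : ℝ}
    (hB : 0 ≤ B) {U : List (Fin n)} (hU : B ≤ (U.map c).sum) {I R : Finset (Fin n)} {t : ℝ}
    {l : List (Fin n)}
    (h : GreedyRun c (fun R i => survivingWeight E wt σ R - survivingWeight E wt σ (insert i R))
      (fun spent => B ≤ spent) I R t l)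
    (ht : 0 ≤ t) (hI : ∀ i ∈ I, c i ≤ B) (hUI : ∀ i ∈ U, c i ≤ B → i ∈ R ∨ i ∈ I)
    {s₀ : ℝ} (hs₀ : 0 ≤ s₀) (hs₀B : s₀ ≤ B)
    (hhalf : survivingWeight E wt σ R ≤
      2 * ∑ a ∈ E.filter (fun a => s₀ ≤ min (exitCost c σ U a) B), wt a) :
    ∑ a ∈ E.filter (fun a => ∀ i ∈ R, a i = σ i), wt a * exitCost c σ l a ≤
      2 * s₀ * survivingWeight E wt σ R +
      4 * ∑ a ∈ E, wt a * max (min (exitCost c σ U a) B - s₀) 0 +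
      4 * ∑ a ∈ E, wt a * min (exitCost c σ U a) B := by
  have hτ : ∀ a, 0 ≤ min (exitCost c σ U a) B := fun a => le_min (exitCost_nonneg hc U a) hB
  have hτsum : 0 ≤ ∑ a ∈ E, wt a * min (exitCost c σ U a) B :=
    Finset.sum_nonneg fun a _ => mul_nonneg (hwt a) (hτ a)
  induction h generalizing s₀ with
  | @done I R t h =>
    have h1 : 0 ≤ survivingWeight E wt σ R := Finset.sum_nonneg fun a _ => hwt a
    have h2 : 0 ≤ ∑ a ∈ E, wt a * max (min (exitCost c σ U a) B - s₀) 0 :=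
      Finset.sum_nonneg fun a _ => mul_nonneg (hwt a) (le_max_right _ _)
    simp only [exitCost, mul_zero, Finset.sum_const_zero]
    have := mul_nonneg hs₀ h1
    linarith
  | @step I R t k l h hk hmax hl ih =>
    have hA : 0 ≤ survivingWeight E wt σ R := Finset.sum_nonneg fun a _ => hwt a
    obtain ⟨s, hs₀s, hsmem, hs1, hs2⟩ := exists_threshold E hwt
      (fun a => min (exitCost c σ U a) B) hA hhalf
    have hsB : s ≤ B := by
      rcases hsmem with rfl | ⟨a, -, rfl⟩
      · exact hs₀B
      · exact min_le_right _ _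
    -- While the threshold is below `B`, truncation does not affect departures at cost at most `s`,
    -- and the density argument applies.
    rcases hsB.lt_or_eq with hsB' | rfl
    · have hstep := removal_step hc hwt hmax (hs₀.trans hs₀s) hsB' hU hUI hs2
      have hanti := survivingWeight_anti (E := E) (wt := wt) (σ := σ) hwt (Finset.subset_insert k R)
      have ih' := ih (by linarith [hc k]) (fun i hi => hI i (Finset.mem_of_mem_erase hi))
        (fun i hi hcB => by
          rcases hUI i hi hcB with h | h
          · simp [h]
          · by_cases hik : i = k
            · simp [hik]
            · simp [hik, h]) (hs₀.trans hs₀s) hsB'.le (hanti.trans hs1)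
      rw [sum_exitCost_cons]
      -- Raising the threshold from `s₀` to `s` lowers the excess `(τ - s₀)⁺` by `s - s₀` wherever
      -- `τ ≥ s`, and this set carries at least half of the surviving weight.
      have hpt : (s - s₀) * ∑ a ∈ E.filter (fun a => s ≤ min (exitCost c σ U a) B), wt a +
          ∑ a ∈ E, wt a * max (min (exitCost c σ U a) B - s) 0 ≤
          ∑ a ∈ E, wt a * max (min (exitCost c σ U a) B - s₀) 0 := by
        rw [Finset.mul_sum, Finset.sum_filter, ← Finset.sum_add_distrib]
        refine Finset.sum_le_sum fun a _ => ?_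
        generalize min (exitCost c σ U a) B = τ
        split_ifs with hτ
        · rw [max_eq_left (by linarith), max_eq_left (by linarith)]
          exact le_of_eq (by ring)
        · rw [max_eq_right (by linarith : τ - s ≤ 0), mul_zero, zero_add]
          exact mul_nonneg (hwt a) (le_max_right _ _)
      have hsA := mul_le_mul_of_nonneg_left hs1 (sub_nonneg.2 hs₀s)
      linarith
    -- The threshold has reached `B`, so at least weight `A / 2` has `τ = B`. The rest of the run
    -- costs at most `2 B` per realization, in total `2 B A ≤ 4 ∑ wt τ`.
    · have hsum := (GreedyRun.step h hk hmax hl).sum_le hB hI ht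
      have h1 : ∑ a ∈ E.filter (fun a => ∀ i ∈ R, a i = σ i), wt a * exitCost c σ (k :: l) a ≤
          2 * s * survivingWeight E wt σ R := by
        rw [survivingWeight, Finset.mul_sum]
        refine Finset.sum_le_sum fun a _ => ?_
        rw [mul_comm]
        exact mul_le_mul_of_nonneg_right ((exitCost_le_sum hc _ a).trans hsum) (hwt a)
      have h2 : s * ∑ a ∈ E.filter (fun a => s ≤ min (exitCost c σ U a) s), wt a ≤
          ∑ a ∈ E, wt a * min (exitCost c σ U a) s := by
        rw [Finset.mul_sum, Finset.sum_filter]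
        refine Finset.sum_le_sum fun a _ => ?_
        split_ifs with h
        · rw [mul_comm]
          exact mul_le_mul_of_nonneg_left h (hwt a)
        · exact mul_nonneg (hwt a) (hτ a)
      have h3 : 0 ≤ ∑ a ∈ E, wt a * max (min (exitCost c σ U a) s - s₀) 0 :=
        Finset.sum_nonneg fun a _ => mul_nonneg (hwt a) (le_max_right _ _)
      have h4 := mul_nonneg hs₀ hA
      have h5 := mul_le_mul_of_nonneg_left hs1 hB
      linarith

/-- Greedily removing weight until the budget `B` is spent costs at most a constant times as much
as any other sequence of items of total cost at least `B`. -/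
theorem GreedyRun.sum_exitCost_le (hc : ∀ i, 0 < c i) (hwt : ∀ a, 0 ≤ wt a) {B : ℝ}
    (hB : 0 ≤ B) {U : List (Fin n)} (hU : B ≤ (U.map c).sum) {I : Finset (Fin n)}
    {l : List (Fin n)}
    (h : GreedyRun c (fun R i => survivingWeight E wt σ R - survivingWeight E wt σ (insert i R))
      (fun spent => B ≤ spent) I ∅ 0 l)
    (hI : ∀ i ∈ I, c i ≤ B) (hUI : ∀ i ∈ U, c i ≤ B → i ∈ I) :
    ∑ a ∈ E, wt a * exitCost c σ l a ≤ 8 * ∑ a ∈ E, wt a * exitCost c σ U a := by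
  have hτ : ∀ a, 0 ≤ min (exitCost c σ U a) B := fun a => le_min (exitCost_nonneg hc U a) hB
  have hW : 0 ≤ ∑ a ∈ E, wt a := Finset.sum_nonneg fun a _ => hwt a
  have key := h.sum_exitCost_le_aux hc hwt hB hU le_rfl hI (fun i hi hcB => Or.inr (hUI i hi hcB))
    (s₀ := 0) le_rfl hB (by simp only [survivingWeight, hτ]; simp; linarith)
  simp only [sub_zero, max_eq_left (hτ _), mul_zero, zero_mul, zero_add] at key
  simp only [Finset.notMem_empty, false_imp_iff, implies_true, Finset.filter_true] at key
  have : ∑ a ∈ E, wt a * min (exitCost c σ U a) B ≤ ∑ a ∈ E, wt a * exitCost c σ U a :=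
    Finset.sum_le_sum fun a _ => mul_le_mul_of_nonneg_left (min_le_left _ _) (hwt a)
  linarith

end Removal

/-! ### Partial realizations -/

section Partial

variable {n : ℕ} {Γ : Type u} {g : PartialRealization n Γ → ℕ} {Q : ℕ}

@[simp] theorem setState_same (b : PartialRealization n Γ) (i : Fin n) (γ : Γ) :
    setState b i γ i = some γ := by
  simp [setState]

theorem setState_of_ne (b : PartialRealization n Γ) {i j : Fin n} (γ : Γ) (h : j ≠ i) :
    setState b i γ j = b j := by
  simp [setState, h]

@[simp] theorem assign_empty (σ : Fin n → Γ) (b : PartialRealization n Γ) : assign σ b ∅ = b := by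
  ext1 i
  simp [assign]

theorem setState_assign (σ : Fin n → Γ) (b : PartialRealization n Γ) (R : Finset (Fin n))
    (i : Fin n) : setState (assign σ b R) i (σ i) = assign σ b (insert i R) := by
  ext1 j
  by_cases h : j = i
  · subst h; simp [assign]
  · simp [setState_of_ne _ _ h, assign, h]

theorem assign_setState (σ : Fin n → Γ) (b : PartialRealization n Γ) (R : Finset (Fin n))
    (i : Fin n) : assign σ (setState b i (σ i)) R = assign σ b (insert i R) := by
  ext1 j
  by_cases h : j = i
  · subst h; simp [assign]
  · simp [setState_of_ne _ _ h, assign, h]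

theorem mem_unknownItems {b : PartialRealization n Γ} {i : Fin n} :
    i ∈ unknownItems b ↔ b i = none := by
  simp [unknownItems]

theorem Extends.trans {b b' b'' : PartialRealization n Γ} (h : Extends b'' b')
    (h' : Extends b' b) : Extends b'' b := fun i hi => by
  have hi' := h' i hi
  rw [← hi'] at hi ⊢
  exact h i hi

theorem extends_setState {b : PartialRealization n Γ} {i : Fin n} (hi : b i = none) (γ : Γ) :
    Extends (setState b i γ) b := fun _ hj =>
  setState_of_ne _ _ fun h => hj (h ▸ hi)

theorem extends_assign (σ : Fin n → Γ) {b : PartialRealization n Γ} {U : Finset (Fin n)}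
    (hU : U ⊆ unknownItems b) : Extends (assign σ b U) b := fun _ hj => by
  rw [assign, if_neg]
  exact fun h => hj (mem_unknownItems.1 (hU h))

theorem extends_assign_assign (σ : Fin n → Γ) {b : PartialRealization n Γ} {U V : Finset (Fin n)}
    (hUV : U ⊆ V) (hV : V ⊆ unknownItems b) : Extends (assign σ b V) (assign σ b U) :=
  fun j hj => by
  by_cases h : j ∈ U
  · simp [assign, h, hUV h]
  · by_cases h' : j ∈ V
    · simp [assign, h, mem_unknownItems.1 (hV h')] at hj
    · simp [assign, h, h']

theorem Extends.setState {b b' : PartialRealization n Γ} (h : Extends b' b) (i : Fin n) (γ : Γ) :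
    Extends (setState b' i γ) (setState b i γ) := fun j hj => by
  by_cases hji : j = i
  · subst hji; simp
  · rw [setState_of_ne _ _ hji] at hj ⊢
    rw [setState_of_ne _ _ hji]
    exact h j hj

theorem card_unknownItems_lt {b b' : PartialRealization n Γ} (h : Extends b' b) {i : Fin n}
    (hi : b i = none) (hi' : b' i ≠ none) : (unknownItems b').card < (unknownItems b).card := by
  refine Finset.card_lt_card ((Finset.ssubset_iff_of_subset fun j hj => ?_).2 ?_)
  · rw [mem_unknownItems] at hj ⊢
    by_contra hne
    exact hne (by rw [← h j hne, hj])
  · exact ⟨i, mem_unknownItems.2 hi, fun h => hi' (mem_unknownItems.1 h)⟩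

theorem IsMonotone.le_of_extends (hg : IsMonotone g) {b b' : PartialRealization n Γ}
    (h : Extends b' b) : g b ≤ g b' := by
  induction hk : (unknownItems b).card using Nat.strong_induction_on generalizing b with
  | _ k ih =>
    by_cases hbb : b = b'
    · rw [hbb]
    · obtain ⟨i, hi⟩ := Function.ne_iff.1 hbb
      have hnone : b i = none := by
        by_contra hne
        exact hi (h i hne).symm
      obtain ⟨γ, hγ⟩ := Option.ne_none_iff_exists'.1 (fun h' => hi (hnone.trans h'.symm))
      refine (hg b i γ hnone).trans (ih _ ?_ (fun j hj => ?_) rfl)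
      · rw [← hk]
        exact card_unknownItems_lt (extends_setState hnone γ) hnone (by simp)
      · by_cases hji : j = i
        · subst hji; simp [hγ]
        · rw [setState_of_ne _ _ hji] at hj ⊢
          exact h j hj

theorem HasGoalValue.eq_of_forall (hQ : HasGoalValue g Q) {b : PartialRealization n Γ}
    (hb : ∀ i, b i ≠ none) : g b = Q := by
  have h : b = full (fun i => (b i).get (Option.isSome_iff_ne_none.2 (hb i))) := by
    ext1 i
    simp [full]
  rw [h]
  exact hQ _

theorem le_goal (hg : IsMonotone g) (hQ : HasGoalValue g Q) (a : Fin n → Γ)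
    (b : PartialRealization n Γ) : g b ≤ Q := by
  rw [← hQ fun i => (b i).getD (a i)]
  refine hg.le_of_extends fun i hi => ?_
  obtain ⟨γ, hγ⟩ := Option.ne_none_iff_exists'.1 hi
  simp [full, hγ]

theorem delta_assign (g : PartialRealization n Γ → ℕ) (σ : Fin n → Γ)
    (b : PartialRealization n Γ) (R : Finset (Fin n)) (i : Fin n) :
    (delta g (assign σ b R) i (σ i) : ℝ) = gainFrom g σ b (insert i R) - gainFrom g σ b R := by
  simp [delta, gainFrom, setState_assign]

theorem isSubmodularOn_gainFrom (hg : IsMonotone g) (hs : IsSubmodular g) (σ : Fin n → Γ)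
    (b : PartialRealization n Γ) : IsSubmodularOn (unknownItems b) (gainFrom g σ b) where
  empty := by simp [gainFrom]
  mono R R' h hR' := by
    have := hg.le_of_extends (extends_assign_assign σ h hR')
    simp only [gainFrom]
    have : (g (assign σ b R) : ℝ) ≤ g (assign σ b R') := by exact_mod_cast this
    linarith
  diminish R R' i h hR' hi hiR' := by
    rw [← delta_assign, ← delta_assign]
    by_cases heq : assign σ b R' = assign σ b R
    · rw [heq]
    · have hb := mem_unknownItems.1 hi
      exact_mod_cast hs _ _ i (σ i) (extends_assign_assign σ h hR') heq
        (by simp [assign, hb, show i ∉ R from fun h' => hiR' (h h')]) (by simp [assign, hb, hiR'])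

theorem gainFrom_unknownItems (hQ : HasGoalValue g Q) (σ : Fin n → Γ)
    (b : PartialRealization n Γ) : gainFrom g σ b (unknownItems b) = (Q : ℝ) - g b := by
  rw [gainFrom, hQ.eq_of_forall fun i => ?_]
  by_cases h : b i = none
  · simp [assign, mem_unknownItems.2 h]
  · rwa [assign, if_neg (fun h' => h (mem_unknownItems.1 h'))]

theorem pathCost_nonneg {c : Fin n → ℝ} (hc : ∀ i, 0 < c i) (T : DTree n Γ) (a : Fin n → Γ) :
    0 ≤ pathCost c T a := by
  induction T with
  | leaf => simp [pathCost]
  | node i child ih =>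
    rw [pathCost]
    linarith [hc i, ih (a i)]

/-- The unknown items that a strategy tests if they turn out to have the states given by `σ`. -/
theorem CoversFrom.exists_path {c : Fin n → ℝ} (hc : ∀ i, 0 < c i) (hg : IsMonotone g)
    (hQ : HasGoalValue g Q) (σ : Fin n → Γ) (b : PartialRealization n Γ) {T : DTree n Γ}
    {r : PartialRealization n Γ} {V : Finset (Fin n)} (hT : CoversFrom g Q T r)
    (hV : V ⊆ unknownItems b) (hr : Extends (assign σ b V) r) :
    ∃ U : List (Fin n), (∀ i ∈ U, i ∈ unknownItems b) ∧ g (assign σ b (V ∪ U.toFinset)) = Q ∧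
      ∀ a, Extends (full a) b → exitCost c σ U a ≤ pathCost c T a := by
  induction T generalizing r V with
  | leaf =>
    refine ⟨[], by simp, ?_, by simp [exitCost, pathCost]⟩
    have h1 := hg.le_of_extends hr
    rw [CoversFrom] at hT
    have h2 := le_goal hg hQ σ (assign σ b V)
    simp
    omega
  | node i child ih =>
    rw [CoversFrom] at hT
    by_cases hi : b i = none
    · have hV' : insert i V ⊆ unknownItems b :=
        Finset.insert_subset (mem_unknownItems.2 hi) hV
      have hr' : Extends (assign σ b (insert i V)) (setState r i (σ i)) := by
        rw [← setState_assign]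
        exact hr.setState i (σ i)
      obtain ⟨U, h1, h2, h3⟩ := ih (σ i) (hT.2 (σ i)) hV' hr'
      refine ⟨i :: U, ?_, ?_, fun a ha => ?_⟩
      · simpa [mem_unknownItems.2 hi] using h1
      · rw [← h2]
        congr 2
        ext j
        simp
      · rw [exitCost, pathCost]
        split_ifs with h
        · rw [h]
          linarith [h3 a ha]
        · linarith [pathCost_nonneg hc (child (a i)) a]
    -- The item is already known in `b`. The path follows its recorded state, as every realization
    -- extending `b` does; only `T` pays for the item.
    · obtain ⟨γ, hγ⟩ := Option.ne_none_iff_exists'.1 hi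
      have hiV : i ∉ V := fun h => hi (mem_unknownItems.1 (hV h))
      have hr' : Extends (assign σ b V) (setState r i γ) := by
        have := hr.setState i γ
        rwa [show setState (assign σ b V) i γ = assign σ b V from
          Function.update_eq_self_iff.2 (by simp [assign, hiV, hγ])] at this
      obtain ⟨U, h1, h2, h3⟩ := ih γ (hT.2 γ) hV hr'
      refine ⟨U, h1, h2, fun a ha => ?_⟩
      have hai : a i = γ := by
        have := ha i hi
        rw [hγ] at this
        simpa [full] using this
      rw [pathCost, hai]
      linarith [h3 a ha, hc i]

end Partial

/-! ### Consistent samples -/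

open scoped Classical in
/-- The elements of the sample that extend `b`. -/
noncomputable def consistent {n : ℕ} {Γ : Type u} (S : Finset (Fin n → Γ))
    (b : PartialRealization n Γ) : Finset (Fin n → Γ) :=
  S.filter (fun a => Extends (full a) b)

section Consistent

variable {n : ℕ} {Γ : Type u} {S : Finset (Fin n → Γ)}

theorem mem_consistent {b : PartialRealization n Γ} {a : Fin n → Γ} :
    a ∈ consistent S b ↔ a ∈ S ∧ Extends (full a) b := by
  simp [consistent]

theorem consistent_anti {b b' : PartialRealization n Γ} (h : Extends b' b) :
    consistent S b' ⊆ consistent S b := fun a ha => by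
  rw [mem_consistent] at ha ⊢
  exact ⟨ha.1, ha.2.trans h⟩

theorem mem_consistent_setState {b : PartialRealization n Γ} {i : Fin n} (hi : b i = none) {γ : Γ}
    {a : Fin n → Γ} : a ∈ consistent S (setState b i γ) ↔ a ∈ consistent S b ∧ a i = γ := by
  constructor
  · intro h
    refine ⟨consistent_anti (extends_setState hi γ) h, ?_⟩
    simpa [full] using (mem_consistent.1 h).2 i (by simp)
  · rintro ⟨h, rfl⟩
    rw [mem_consistent] at h ⊢
    refine ⟨h.1, fun j hj => ?_⟩
    by_cases hji : j = i
    · subst hji; simp [full]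
    · rw [setState_of_ne _ _ hji] at hj ⊢
      exact h.2 j hj

theorem sum_consistent [Fintype Γ] {b : PartialRealization n Γ} {i : Fin n} (hi : b i = none)
    (F : (Fin n → Γ) → ℝ) :
    ∑ a ∈ consistent S b, F a = ∑ γ, ∑ a ∈ consistent S (setState b i γ), F a := by
  classical
  rw [← Finset.sum_fiberwise (consistent S b) (fun a => a i) F]
  refine Finset.sum_congr rfl fun γ _ => Finset.sum_congr ?_ fun _ _ => rfl
  ext a
  rw [mem_consistent_setState hi, Finset.mem_filter]

/-- Removed and surviving weight add up to a constant, so the first stage is a greedy run for the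
decrease of the surviving weight. -/
theorem removedWeight_eq (w : (Fin n → Γ) → ℕ) (σ : Fin n → Γ) (b : PartialRealization n Γ)
    (R : Finset (Fin n)) : removedWeight S w σ b R =
      ∑ a ∈ consistent S b, (w a : ℝ) -
        survivingWeight (consistent S b) (fun a => (w a : ℝ)) σ R := by
  classical
  rw [eq_sub_iff_add_eq, survivingWeight, consistent, removedWeight, Finset.filter_filter,
    Finset.sum_filter, Finset.sum_filter, Finset.sum_filter, ← Finset.sum_add_distrib]
  refine Finset.sum_congr rfl fun a _ => ?_
  split_ifs <;> grind

/-- The cost of a tree with a backbone: the items on the backbone, and the subtrees. -/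
theorem sum_pathCost_backbone_le [Finite Γ] {c : Fin n → ℝ} {wt F : (Fin n → Γ) → ℝ} {X : ℝ}
    {σ : Fin n → Γ} {side : Fin n → Γ → DTree n Γ} {last : DTree n Γ} (l : List (Fin n))
    (b : PartialRealization n Γ) (hl : l.Nodup) (hb : ∀ i ∈ l, b i = none)
    (h_side : ∀ pre post i, l = pre ++ i :: post → ∀ γ, γ ≠ σ i →
      ∑ a ∈ consistent S (setState (assign σ b pre.toFinset) i γ), wt a * pathCost c (side i γ) a ≤
        X * ∑ a ∈ consistent S (setState (assign σ b pre.toFinset) i γ), F a)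
    (h_last : ∑ a ∈ consistent S (assign σ b l.toFinset), wt a * pathCost c last a ≤
      X * ∑ a ∈ consistent S (assign σ b l.toFinset), F a) :
    ∑ a ∈ consistent S b, wt a * pathCost c (backbone σ side last l) a ≤
      ∑ a ∈ consistent S b, wt a * exitCost c σ l a + X * ∑ a ∈ consistent S b, F a := by
  have := Fintype.ofFinite Γ
  induction l generalizing b with
  | nil => simpa [backbone, exitCost] using h_last
  | cons i l ih =>
    have hi : b i = none := hb i (by simp)
    rw [List.nodup_cons] at hl
    rw [sum_consistent hi, sum_consistent hi, sum_consistent hi F, Finset.mul_sum,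
      ← Finset.sum_add_distrib]
    refine Finset.sum_le_sum fun γ _ => ?_
    have hstate : ∀ a ∈ consistent S (setState b i γ), a i = γ := fun a ha =>
      ((mem_consistent_setState hi).1 ha).2
    by_cases hγ : γ = σ i
    · subst hγ
      have key := ih (setState b i (σ i)) hl.2
        (fun j hj => by
          rw [setState_of_ne _ _ (ne_of_mem_of_not_mem hj hl.1)]
          exact hb j (by simp [hj]))
        (fun pre post j hpre γ hγ => by
          rw [assign_setState, ← List.toFinset_cons]
          exact h_side (i :: pre) post j (by simp [hpre]) γ hγ)
        (by rwa [assign_setState, ← List.toFinset_cons])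
      have e1 : ∑ a ∈ consistent S (setState b i (σ i)),
          wt a * pathCost c (backbone σ side last (i :: l)) a =
          ∑ a ∈ consistent S (setState b i (σ i)), wt a * c i +
          ∑ a ∈ consistent S (setState b i (σ i)), wt a * pathCost c (backbone σ side last l) a := by
        rw [← Finset.sum_add_distrib]
        refine Finset.sum_congr rfl fun a ha => ?_
        simp only [backbone, pathCost, hstate a ha, if_true]
        ring
      have e2 : ∑ a ∈ consistent S (setState b i (σ i)), wt a * exitCost c σ (i :: l) a =
          ∑ a ∈ consistent S (setState b i (σ i)), wt a * c i +
          ∑ a ∈ consistent S (setState b i (σ i)), wt a * exitCost c σ l a := by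
        rw [← Finset.sum_add_distrib]
        refine Finset.sum_congr rfl fun a ha => ?_
        simp only [exitCost, hstate a ha, if_true]
        ring
      rw [e1, e2]
      linarith
    · have key := h_side [] l i rfl γ hγ
      rw [List.toFinset_nil, assign_empty] at key
      have e1 : ∑ a ∈ consistent S (setState b i γ),
          wt a * pathCost c (backbone σ side last (i :: l)) a =
          ∑ a ∈ consistent S (setState b i γ), wt a * c i +
          ∑ a ∈ consistent S (setState b i γ), wt a * pathCost c (side i γ) a := by
        rw [← Finset.sum_add_distrib]
        refine Finset.sum_congr rfl fun a ha => ?_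
        have hne : a i ≠ σ i := by rwa [hstate a ha]
        simp only [backbone, pathCost, if_neg hne]
        rw [hstate a ha]
        ring
      have e2 : ∑ a ∈ consistent S (setState b i γ), wt a * exitCost c σ (i :: l) a =
          ∑ a ∈ consistent S (setState b i γ), wt a * c i := by
        refine Finset.sum_congr rfl fun a ha => ?_
        have hne : a i ≠ σ i := by rwa [hstate a ha]
        simp only [exitCost, if_neg hne, add_zero]
      rw [e1, e2]
      linarith

theorem coversFrom_backbone {g : PartialRealization n Γ → ℕ} {Q : ℕ} {σ : Fin n → Γ}
    {side : Fin n → Γ → DTree n Γ} {last : DTree n Γ} (l : List (Fin n))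
    (b : PartialRealization n Γ) (hl : l.Nodup) (hb : ∀ i ∈ l, b i = none)
    (h_side : ∀ pre post i, l = pre ++ i :: post → ∀ γ, γ ≠ σ i →
      CoversFrom g Q (side i γ) (setState (assign σ b pre.toFinset) i γ))
    (h_last : CoversFrom g Q last (assign σ b l.toFinset)) :
    CoversFrom g Q (backbone σ side last l) b := by
  induction l generalizing b with
  | nil => simpa [backbone] using h_last
  | cons i l ih =>
    have hi : b i = none := hb i (by simp)
    rw [List.nodup_cons] at hl
    rw [backbone, CoversFrom]
    refine ⟨hi, fun γ => ?_⟩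
    split_ifs with hγ
    · subst hγ
      refine ih (setState b i (σ i)) hl.2 (fun j hj => ?_) (fun pre post j hpre γ hγ => ?_) ?_
      · rw [setState_of_ne _ _ (ne_of_mem_of_not_mem hj hl.1)]
        exact hb j (by simp [hj])
      · rw [assign_setState, ← List.toFinset_cons]
        exact h_side (i :: pre) post j (by simp [hpre]) γ hγ
      · rwa [assign_setState, ← List.toFinset_cons]
    · simpa using h_side [] l i rfl γ hγ

end Consistent

/-! ### Analysis of Mixed Greedy -/

section Stages

variable {n : ℕ} {Γ : Type u} {g : PartialRealization n Γ → ℕ} {S : Finset (Fin n → Γ)}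
  {w : (Fin n → Γ) → ℕ} {c : Fin n → ℝ} {tie₁ tie₂ : Finset (Fin n) → Fin n} {σ : Fin n → Γ}
  {b : PartialRealization n Γ} {B : ℝ}

theorem stageOne_run (h₁ : IsTieRule tie₁) :
    GreedyRun c (fun R i => survivingWeight (consistent S b) (fun a => (w a : ℝ)) σ R -
        survivingWeight (consistent S b) (fun a => (w a : ℝ)) σ (insert i R))
      (fun spent => B ≤ spent) ((unknownItems b).filter (fun i => c i ≤ B)) ∅ 0
      (stageOne S w c tie₁ σ b B) := by
  have h := greedyLoop_run (c := c)
    (gain := fun R i => removedWeight S w σ b (insert i R) - removedWeight S w σ b R)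
    (halt := fun spent => B ≤ spent) h₁ ((unknownItems b).filter (fun i => c i ≤ B)) ∅ 0
  have hgain : (fun R i => removedWeight S w σ b (insert i R) - removedWeight S w σ b R) =
      fun R i => survivingWeight (consistent S b) (fun a => (w a : ℝ)) σ R -
        survivingWeight (consistent S b) (fun a => (w a : ℝ)) σ (insert i R) := by
    funext R i
    rw [removedWeight_eq, removedWeight_eq]
    ring
  rw [← hgain]
  exact h

theorem stageTwo_run (h₂ : IsTieRule tie₂) (R₁ : Finset (Fin n)) :
    GreedyRun c (fun R i => gainFrom g σ b (insert i R) - gainFrom g σ b R)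
      (fun spent => B ≤ spent) ((unknownItems b).filter (fun i => c i ≤ B) \ R₁) R₁ 0
      (stageTwo g c tie₂ σ b B R₁) := by
  simp only [← delta_assign]
  exact greedyLoop_run h₂ _ _ _

theorem stages_unknown (h₁ : IsTieRule tie₁) (h₂ : IsTieRule tie₂) :
    ∀ i ∈ stageOne S w c tie₁ σ b B ++
      stageTwo g c tie₂ σ b B (stageOne S w c tie₁ σ b B).toFinset, i ∈ unknownItems b := by
  intro i hi
  rcases List.mem_append.1 hi with hi | hi
  · exact Finset.mem_of_mem_filter i ((stageOne_run h₁).mem i hi)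
  · exact Finset.mem_of_mem_filter i (Finset.mem_sdiff.1 ((stageTwo_run h₂ _).mem i hi)).1

theorem stages_nodup (h₁ : IsTieRule tie₁) (h₂ : IsTieRule tie₂) :
    (stageOne S w c tie₁ σ b B ++
      stageTwo g c tie₂ σ b B (stageOne S w c tie₁ σ b B).toFinset).Nodup := by
  refine List.Nodup.append (stageOne_run h₁).nodup (stageTwo_run h₂ _).nodup fun i hi hi' => ?_
  have := (Finset.mem_sdiff.1 ((stageTwo_run h₂ _).mem i hi')).2
  exact this (List.mem_toFinset.2 hi)

theorem stageOne_spends (hc : ∀ i, 0 < c i) (h₁ : IsTieRule tie₁)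
    {tie₀ : Finset (Fin n) → Fin n}
    (hB : IsBudget c tie₀ (unknownItems b) (gainFrom g σ b) B) :
    B ≤ ((stageOne S w c tie₁ σ b B).map c).sum := by
  rcases (stageOne_run (S := S) (w := w) (c := c) (σ := σ) (b := b) (B := B) h₁).halt_or_exhausted
    with h | h
  · simpa using h
  · exact (hB.le_sum_filter hc).trans ((Finset.sum_le_sum_of_subset_of_nonneg
      (fun i hi => List.mem_toFinset.2 (h i hi)) fun i _ _ => (hc i).le).trans
        (sum_toFinset_le hc _))

end Stages

/-- A bound, up to a constant, on the number of recursive calls on a path when the distance to the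
goal value is `d`. -/
noncomputable def level (d : ℕ) : ℝ :=
  if d = 0 then 0 else 1 + Real.log d / -Real.log (1 - alpha / 2)

theorem neg_log_pos : 0 < -Real.log (1 - alpha / 2) := by
  have := Real.log_neg (x := 1 - alpha / 2) (by linarith [alpha_le_half]) (by linarith [alpha_pos])
  linarith

theorem level_le {d D : ℕ} (h : d ≤ D) :
    level d ≤ (1 + 1 / -Real.log (1 - alpha / 2)) * (1 + Real.log D) := by
  have h1 := one_div_pos.2 neg_log_pos
  have h2 : 0 ≤ Real.log D := Real.log_natCast_nonneg D
  rw [level]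
  split_ifs with h0
  · positivity
  · have h3 : Real.log d ≤ Real.log D :=
      Real.log_le_log (by exact_mod_cast Nat.pos_of_ne_zero h0) (by exact_mod_cast h)
    have h4 := mul_le_mul_of_nonneg_right h3 h1.le
    rw [div_eq_mul_one_div]
    linarith

/-- The logarithm drops by at least `-log (1 - α/2)`. If `d = 0`, the drop by one comes from the
summand `1` in `level D`. -/
theorem level_add_one_le {d D : ℕ} (hD : D ≠ 0) (h : (d : ℝ) ≤ (1 - alpha / 2) * D) :
    level d ≤ level D - 1 := by
  have hD' : (1 : ℝ) ≤ D := by exact_mod_cast Nat.one_le_iff_ne_zero.2 hD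
  rw [level, level, if_neg hD]
  split_ifs with h0
  · have := div_nonneg (Real.log_nonneg hD') neg_log_pos.le
    linarith
  · have hd : (0 : ℝ) < d := by exact_mod_cast Nat.pos_of_ne_zero h0
    have h1 : 0 < 1 - alpha / 2 := by linarith [alpha_le_half]
    have h2 := Real.log_le_log hd h
    rw [Real.log_mul h1.ne' (by linarith)] at h2
    have h3 := neg_log_pos
    have h4 : Real.log d / -Real.log (1 - alpha / 2) ≤
        (Real.log (1 - alpha / 2) + Real.log D) / -Real.log (1 - alpha / 2) :=
      div_le_div_of_nonneg_right h2 h3.le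
    have h5 : Real.log (1 - alpha / 2) / -Real.log (1 - alpha / 2) = -1 := by
      rw [div_neg, div_self (by linarith)]
    rw [add_div, h5] at h4
    linarith

section Analysis

variable {n : ℕ} {Γ : Type u} {g : PartialRealization n Γ → ℕ} {Q : ℕ} {S : Finset (Fin n → Γ)}
  {w : (Fin n → Γ) → ℕ} {c : Fin n → ℝ}

theorem MixedGreedy.coversFrom {b : PartialRealization n Γ} {T : DTree n Γ}
    (h : MixedGreedy g Q S w c b T) : CoversFrom g Q T b := by
  induction h with
  | leaf b hb => exact hb
  | node b σ B tie₀ tie₁ tie₂ l₁ l₂ side last hb hσ h_tie₀ h_tie₁ h_tie₂ hB h_stage₁ h_spent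
      h_stage₂ h_side h_last ih_side ih_last =>
    subst h_stage₁ h_stage₂
    exact coversFrom_backbone _ b (stages_nodup h_tie₁ h_tie₂)
      (fun i hi => mem_unknownItems.1 (stages_unknown h_tie₁ h_tie₂ i hi))
      (fun pre post i hl => ih_side pre post i hl) ih_last

theorem exists_tieRule (i₀ : Fin n) : ∃ tie : Finset (Fin n) → Fin n, IsTieRule tie := by
  classical
  refine ⟨fun A => if h : A.Nonempty then h.choose else i₀, fun A hA => ?_⟩
  simp only [dif_pos hA]
  exact hA.choose_spec

theorem exists_isWorstState [Finite Γ] (g : PartialRealization n Γ → ℕ) (a : Fin n → Γ)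
    (b : PartialRealization n Γ) : ∃ σ : Fin n → Γ, ∀ i, IsWorstState g b i (σ i) := by
  have h : ∀ i, ∃ γ, IsWorstState g b i γ := fun i =>
    have : Nonempty Γ := ⟨a i⟩
    Finite.exists_min (fun γ => delta g b i γ)
  choose σ hσ using h
  exact ⟨σ, hσ⟩

theorem exists_mixedGreedy [Finite Γ] (hg : IsMonotone g) (hs : IsSubmodular g)
    (hQ : HasGoalValue g Q) (hc : ∀ i, 0 < c i) (a : Fin n → Γ) (b : PartialRealization n Γ) :
    ∃ T, MixedGreedy g Q S w c b T := by
  classical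
  induction hk : (unknownItems b).card using Nat.strong_induction_on generalizing b with
  | _ k ih =>
    by_cases hb : g b = Q
    · exact ⟨_, .leaf b hb⟩
    have hlt : g b < Q := lt_of_le_of_ne (le_goal hg hQ a b) hb
    obtain ⟨i₀, -⟩ : ∃ i, b i = none := by
      by_contra! h
      exact hb (hQ.eq_of_forall h)
    obtain ⟨tie, htie⟩ := exists_tieRule i₀
    obtain ⟨σ, hσ⟩ := exists_isWorstState g a b
    have hsub := isSubmodularOn_gainFrom hg hs σ b
    obtain ⟨B, hB⟩ := hsub.exists_isBudget hc htie
    have hpos : 0 < gainFrom g σ b (unknownItems b) := by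
      rw [gainFrom_unknownItems hQ, sub_pos]
      exact_mod_cast hlt
    have hBpos := hsub.budget_pos hc htie hB hpos
    have hspent := stageOne_spends (S := S) (w := w) hc htie hB
    have hunk := stages_unknown (g := g) (S := S) (w := w) (c := c) (σ := σ) (b := b) (B := B)
      htie htie
    have hnd := stages_nodup (g := g) (S := S) (w := w) (c := c) (σ := σ) (b := b) (B := B)
      htie htie
    have hl₁ : stageOne S w c tie σ b B ≠ [] := by
      intro h
      rw [h] at hspent
      simp at hspent
      linarith
    set l := stageOne S w c tie σ b B ++
      stageTwo g c tie σ b B (stageOne S w c tie σ b B).toFinset with hl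
    have hsubset : ∀ l' : List (Fin n), (∀ i ∈ l', i ∈ l) → l'.toFinset ⊆ unknownItems b :=
      fun l' h i hi => hunk i (h i (List.mem_toFinset.1 hi))
    -- The subtree must depend on `i` and `γ` alone. It may, because the backbone repeats no item,
    -- so `i` determines the prefix before it.
    have hside : ∀ i γ, ∃ T, ∀ pre post, l = pre ++ i :: post →
        MixedGreedy g Q S w c (setState (assign σ b pre.toFinset) i γ) T := by
      intro i γ
      by_cases hi : ∃ pre post, l = pre ++ i :: post
      · obtain ⟨pre, post, hpre⟩ := hi
        have hbi : b i = none := mem_unknownItems.1 (hunk i (by simp [hpre]))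
        have hipre : i ∉ pre := by
          rw [hpre, List.nodup_append] at hnd
          exact fun h => hnd.2.2 i h i (by simp) rfl
        have hext : Extends (setState (assign σ b pre.toFinset) i γ) b :=
          (extends_setState (by simp [assign, hipre, hbi]) γ).trans
            (extends_assign σ (hsubset pre fun j hj => by simp [hpre, hj]))
        obtain ⟨T, hT⟩ := ih _ (hk ▸ card_unknownItems_lt hext hbi (by simp)) _ rfl
        refine ⟨T, fun pre' post' hpre' => ?_⟩
        have hipre' : i ∉ pre' := by
          rw [hpre', List.nodup_append] at hnd
          exact fun h => hnd.2.2 i h i (by simp) rfl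
        have : pre = pre' := by
          have h1 : l.takeWhile (· ≠ i) = pre := by
            rw [hpre, List.takeWhile_append_of_pos]
            · simp
            · intro j hj
              simpa using ne_of_mem_of_not_mem hj hipre
          have h2 : l.takeWhile (· ≠ i) = pre' := by
            rw [hpre', List.takeWhile_append_of_pos]
            · simp
            · intro j hj
              simpa using ne_of_mem_of_not_mem hj hipre'
          rw [← h1, h2]
        rwa [← this]
      · exact ⟨.leaf, fun pre post h => (hi ⟨pre, post, h⟩).elim⟩
    choose side hside using hside
    obtain ⟨i, hi⟩ := List.exists_mem_of_ne_nil l (by simp [hl, hl₁])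
    have hlast := card_unknownItems_lt (extends_assign σ (hsubset l fun _ h => h))
      (mem_unknownItems.1 (hunk i hi)) (i := i) (by simp [assign, hi])
    obtain ⟨last, hlast⟩ := ih _ (hk ▸ hlast) _ rfl
    exact ⟨_, .node b σ B tie tie tie _ _ side last hb (fun i _ => hσ i) htie htie htie hB rfl
      hspent rfl (fun pre post i h γ _ => hside i γ pre post h) hlast⟩

/-- The backbone costs at most a constant times as much as any strategy. -/
theorem sum_exitCost_stages_le (hg : IsMonotone g) (hs : IsSubmodular g) (hQ : HasGoalValue g Q)
    (hc : ∀ i, 0 < c i) {T' : DTree n Γ} (hT' : IsStrategy g Q T') {b : PartialRealization n Γ}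
    {σ : Fin n → Γ} {B : ℝ} {tie₀ tie₁ tie₂ : Finset (Fin n) → Fin n} (h₀ : IsTieRule tie₀)
    (h₁ : IsTieRule tie₁) (h₂ : IsTieRule tie₂)
    (hB : IsBudget c tie₀ (unknownItems b) (gainFrom g σ b) B) :
    ∑ a ∈ consistent S b, (w a : ℝ) * exitCost c σ (stageOne S w c tie₁ σ b B ++
        stageTwo g c tie₂ σ b B (stageOne S w c tie₁ σ b B).toFinset) a ≤
      24 * ∑ a ∈ consistent S b, (w a : ℝ) * pathCost c T' a := by
  have hsub := isSubmodularOn_gainFrom hg hs σ b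
  obtain ⟨U, hU, hUQ, hUcost⟩ := CoversFrom.exists_path hc hg hQ σ b hT' (V := ∅) (by simp)
    (fun i hi => absurd rfl hi)
  rw [Finset.empty_union] at hUQ
  -- `U` attains the full utility, so its cost is an admissible budget, and `B` is the smallest one.
  have hUB : B ≤ (U.map c).sum :=
    (hsub.budget_le hc h₀ hB (fun i hi => hU i (List.mem_toFinset.1 hi))
      (by rw [gainFrom_unknownItems hQ, gainFrom, hUQ])).trans (sum_toFinset_le hc U)
  have hwt : ∀ a, 0 ≤ (w a : ℝ) := fun a => Nat.cast_nonneg _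
  have hone := (stageOne_run (S := S) (w := w) (c := c) (σ := σ) (b := b) (B := B)
    h₁).sum_exitCost_le hc hwt hB.1.1 hUB (fun i hi => (Finset.mem_filter.1 hi).2)
    (fun i hi hcB => Finset.mem_filter.2 ⟨hU i hi, hcB⟩)
  have htwo := (stageTwo_run (g := g) (c := c) (σ := σ) (b := b) (B := B) h₂
    (stageOne S w c tie₁ σ b B).toFinset).sum_le hB.1.1
    (fun i hi => (Finset.mem_filter.1 (Finset.mem_sdiff.1 hi).1).2) le_rfl
  have hspent := stageOne_spends (S := S) (w := w) hc h₁ hB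
  calc _ ≤ ∑ a ∈ consistent S b, 3 * ((w a : ℝ) * exitCost c σ (stageOne S w c tie₁ σ b B) a) := by
        refine Finset.sum_le_sum fun a _ => ?_
        have := mul_le_mul_of_nonneg_left (exitCost_append_le (σ := σ) hc hspent htwo a) (hwt a)
        linarith
    _ ≤ 24 * ∑ a ∈ consistent S b, (w a : ℝ) * exitCost c σ U a := by
        rw [← Finset.mul_sum]
        linarith
    _ ≤ _ := by
        refine mul_le_mul_of_nonneg_left (Finset.sum_le_sum fun a ha => ?_) (by norm_num)
        exact mul_le_mul_of_nonneg_left (hUcost a (mem_consistent.1 ha).2) (hwt a)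

/-- If every state other than the worst one closes at least half of the distance to the goal value,
then the cost of Mixed Greedy is at most a logarithmic factor times that of any strategy. -/
theorem MixedGreedy.cost_le [Finite Γ] (hg : IsMonotone g) (hs : IsSubmodular g)
    (hQ : HasGoalValue g Q) (hc : ∀ i, 0 < c i)
    (hρ : ∀ b i γ₀ γ, g b < Q → b i = none → IsWorstState g b i γ₀ → γ ≠ γ₀ →
      (Q : ℤ) - g b ≤ 2 * delta g b i γ)
    {T' : DTree n Γ} (hT' : IsStrategy g Q T') {b : PartialRealization n Γ} {T : DTree n Γ}
    (h : MixedGreedy g Q S w c b T) :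
    ∑ a ∈ consistent S b, (w a : ℝ) * pathCost c T a ≤
      24 * level (Q - g b) * ∑ a ∈ consistent S b, (w a : ℝ) * pathCost c T' a := by
  induction h with
  | leaf b hb => simp [pathCost, level, hb]
  | node b σ B tie₀ tie₁ tie₂ l₁ l₂ side last hb hσ h_tie₀ h_tie₁ h_tie₂ hB h_stage₁ h_spent
      h_stage₂ h_side h_last ih_side ih_last =>
    subst h_stage₁ h_stage₂
    have hlt : g b < Q := lt_of_le_of_ne (le_goal hg hQ σ b) hb
    have hbackbone := sum_exitCost_stages_le (S := S) (w := w) hg hs hQ hc hT' h_tie₀ h_tie₁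
      h_tie₂ hB
    have hunk := stages_unknown (g := g) (S := S) (w := w) (c := c) (σ := σ) (b := b) (B := B)
      h_tie₁ h_tie₂
    have hnd := stages_nodup (g := g) (S := S) (w := w) (c := c) (σ := σ) (b := b) (B := B)
      h_tie₁ h_tie₂
    have hsub := isSubmodularOn_gainFrom hg hs σ b
    have hN := gainFrom_unknownItems hQ σ b
    have hltR : (g b : ℝ) < Q := by exact_mod_cast hlt
    have htwo := hsub.greedyRun_budget hc h_tie₀ hB (by rw [hN]; linarith)
      (fun i hi => hunk i (List.mem_append_left _ (List.mem_toFinset.1 hi)))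
      (stageTwo_run h_tie₂ (stageOne S w c tie₁ σ b B).toFinset)
    rw [← List.toFinset_append, hN, gainFrom] at htwo
    set l := stageOne S w c tie₁ σ b B ++
      stageTwo g c tie₂ σ b B (stageOne S w c tie₁ σ b B).toFinset
    have hd : Q - g b ≠ 0 := by omega
    -- A call that starts `α/2` closer to the goal has its level lowered by at least one. The 24
    -- units saved pay for the backbone of the present call.
    have hstep : ∀ b', (g b' : ℝ) ≥ g b + alpha / 2 * (Q - g b) →
        24 * level (Q - g b') * ∑ a ∈ consistent S b', (w a : ℝ) * pathCost c T' a ≤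
          24 * (level (Q - g b) - 1) * ∑ a ∈ consistent S b', (w a : ℝ) * pathCost c T' a := by
      intro b' hb'
      have hle := level_add_one_le (d := Q - g b') hd (by
        rw [Nat.cast_sub (le_goal hg hQ σ b'), Nat.cast_sub hlt.le]
        linarith)
      have hnn : 0 ≤ ∑ a ∈ consistent S b', (w a : ℝ) * pathCost c T' a :=
        Finset.sum_nonneg fun a _ => mul_nonneg (Nat.cast_nonneg _) (pathCost_nonneg hc T' a)
      exact mul_le_mul_of_nonneg_right (by linarith) hnn
    have hcost := sum_pathCost_backbone_le (S := S) (c := c) (wt := fun a => (w a : ℝ))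
      (F := fun a => (w a : ℝ) * pathCost c T' a) (X := 24 * (level (Q - g b) - 1)) (σ := σ)
      (side := side) (last := last) l b hnd (fun i hi => mem_unknownItems.1 (hunk i hi))
      (fun pre post i hl γ hγ => by
        refine (ih_side pre post i hl γ hγ).trans (hstep _ ?_)
        have hbi : b i = none := mem_unknownItems.1 (hunk i (by simp [hl]))
        -- `σ i` is a worst state at `b`, not at the later node, so the bound is applied at `b` and
        -- carried to the node by monotonicity.
        have h1 := hρ b i (σ i) γ hlt hbi (hσ i hbi) hγ
        have h2 := hg.le_of_extends ((extends_assign σ (b := b) (U := pre.toFinset) fun j hj =>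
          hunk j (by simp [hl, List.mem_toFinset.1 hj])).setState i γ)
        rw [delta] at h1
        have h3 : (Q : ℝ) - g b ≤ 2 * (g (setState b i γ) - g b) := by exact_mod_cast h1
        have h4 : (g (setState b i γ) : ℝ) ≤ g (setState (assign σ b pre.toFinset) i γ) := by
          exact_mod_cast h2
        have h5 := mul_le_mul_of_nonneg_right alpha_le_half (sub_nonneg.2 hltR.le)
        linarith)
      (ih_last.trans (hstep _ (by linarith)))
    linarith

end Analysis

/-! ### The utility function `g_S` -/

section UtilityGS

variable {n : ℕ} {Γ : Type u}

theorem card_consistent_setState (S : Finset (Fin n → Γ)) {b : PartialRealization n Γ} {i : Fin n}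
    (hi : b i = none) (γ : Γ) :
    ∃ E : Finset (Fin n → Γ), (∀ a, a ∈ E ↔ a ∈ consistent S b ∧ a i ≠ γ) ∧
      (consistent S (setState b i γ)).card + E.card = (consistent S b).card := by
  classical
  refine ⟨(consistent S b).filter (fun a => a i ≠ γ), by simp, ?_⟩
  rw [← Finset.card_filter_add_card_filter_not (s := consistent S b) (fun a => a i = γ)]
  congr 2
  ext a
  rw [mem_consistent_setState hi, Finset.mem_filter]

namespace ScenarioSC

variable (P : ScenarioSC n Γ)

theorem g_le (b : PartialRealization n Γ) : P.g b ≤ P.Q :=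
  le_goal P.monotone_g P.goal_g P.S_nonempty.choose b

/-- Both truncated subtractions in the OR construction are exact here, and `m - h_S(b)` is the
number of consistent samples. Everything about `g_S` is read off this product. -/
theorem goal_sub_gS (b : PartialRealization n Γ) :
    ((P.Q * P.S.card : ℕ) : ℤ) - P.gS b = ((P.Q : ℤ) - P.g b) * (consistent P.S b).card := by
  have h1 := P.g_le b
  have h2 : (consistent P.S b).card ≤ P.S.card :=
    Finset.card_le_card fun a ha => (mem_consistent.1 ha).1
  have h3 : P.gS b = P.Q * P.S.card - (P.Q - P.g b) * (consistent P.S b).card := by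
    change P.Q * P.S.card - (P.Q - P.g b) * (P.S.card - (P.S.card - (consistent P.S b).card)) = _
    rw [Nat.sub_sub_self h2]
  have h4 : (P.Q - P.g b) * (consistent P.S b).card ≤ P.Q * P.S.card :=
    Nat.mul_le_mul (Nat.sub_le _ _) h2
  rw [h3, Nat.cast_sub h4, ← Nat.cast_sub h1]
  push_cast
  ring

theorem gS_eq_iff (b : PartialRealization n Γ) :
    P.gS b = P.Q * P.S.card ↔ P.g b = P.Q ∨ consistent P.S b = ∅ := by
  have h := P.goal_sub_gS b
  have h0 : P.gS b = P.Q * P.S.card ↔ ((P.Q * P.S.card : ℕ) : ℤ) - P.gS b = 0 := by omega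
  rw [h0, h, mul_eq_zero, Nat.cast_eq_zero, Finset.card_eq_zero]
  refine or_congr_left ?_
  omega

theorem delta_gS (b : PartialRealization n Γ) (i : Fin n) (γ : Γ) :
    delta P.gS b i γ = ((P.Q : ℤ) - P.g b) * (consistent P.S b).card -
      ((P.Q : ℤ) - P.g (setState b i γ)) * (consistent P.S (setState b i γ)).card := by
  rw [← goal_sub_gS, ← goal_sub_gS, delta]
  ring

/-- A form in which all four factors are nonnegative and none increases when `b` is extended.
Monotonicity and submodularity follow factor by factor. -/
theorem delta_gS_eq_add (b : PartialRealization n Γ) (i : Fin n) (γ : Γ) :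
    delta P.gS b i γ = ((P.Q : ℤ) - P.g b) *
        ((consistent P.S b).card - (consistent P.S (setState b i γ)).card) +
      (consistent P.S (setState b i γ)).card * delta P.g b i γ := by
  rw [delta_gS, delta]
  ring

theorem monotone_gS : IsMonotone P.gS := fun b i γ hi => by
  have h1 := P.delta_gS_eq_add b i γ
  have h2 : (0 : ℤ) ≤ (P.Q : ℤ) - P.g b := by have := P.g_le b; omega
  have h3 : (0 : ℤ) ≤ (consistent P.S b).card - (consistent P.S (setState b i γ)).card := by
    have := Finset.card_le_card (consistent_anti (S := P.S) (extends_setState hi γ))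
    omega
  have h4 : 0 ≤ delta P.g b i γ := by
    have := P.monotone_g b i γ hi
    rw [delta]
    omega
  have h5 : 0 ≤ delta P.gS b i γ := by
    rw [h1]
    exact add_nonneg (mul_nonneg h2 h3) (mul_nonneg (Int.natCast_nonneg _) h4)
  rw [delta] at h5
  omega

theorem submodular_gS : IsSubmodular P.gS := fun b b' i γ hext hne hi hi' => by
  rw [delta_gS_eq_add, delta_gS_eq_add]
  obtain ⟨E, hE, hcard⟩ := card_consistent_setState P.S hi γ
  obtain ⟨E', hE', hcard'⟩ := card_consistent_setState P.S hi' γ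
  have h1 : E'.card ≤ E.card := Finset.card_le_card fun a ha => by
    rw [hE'] at ha
    rw [hE]
    exact ⟨consistent_anti hext ha.1, ha.2⟩
  have h2 := Finset.card_le_card (consistent_anti (S := P.S) (hext.setState i γ))
  have h3 := P.submodular_g b b' i γ hext hne hi hi'
  have h4 := P.monotone_g.le_of_extends hext
  have h5 := P.g_le b'
  have h6 : 0 ≤ delta P.g b' i γ := by
    have := P.monotone_g b' i γ hi'
    rw [delta]
    omega
  refine add_le_add (mul_le_mul (by omega) (by omega) (by omega) (by omega))
    (mul_le_mul (by omega) h3 h6 (by omega))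

theorem goal_gS : HasGoalValue P.gS (P.Q * P.S.card) := fun a =>
  (P.gS_eq_iff _).2 (Or.inl (P.goal_g a))

theorem goal_sub_gS_le_of_card {b : PartialRealization n Γ} {i : Fin n} (hi : b i = none) {γ : Γ}
    (h : 2 * (consistent P.S (setState b i γ)).card ≤ (consistent P.S b).card) :
    ((P.Q * P.S.card : ℕ) : ℤ) - P.gS b ≤ 2 * delta P.gS b i γ := by
  rw [goal_sub_gS, delta_gS]
  have h1 := P.monotone_g b i γ hi
  have h2 := P.g_le b
  have h3 : ((P.Q : ℤ) - P.g (setState b i γ)) * (consistent P.S (setState b i γ)).card ≤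
      ((P.Q : ℤ) - P.g b) * (consistent P.S (setState b i γ)).card :=
    mul_le_mul_of_nonneg_right (by omega) (by omega)
  have h4 : ((P.Q : ℤ) - P.g b) * (2 * (consistent P.S (setState b i γ)).card) ≤
      ((P.Q : ℤ) - P.g b) * (consistent P.S b).card :=
    mul_le_mul_of_nonneg_left (by exact_mod_cast h) (by omega)
  linarith

/-- Any state other than the worst one closes at least half of the distance to the goal value. -/
theorem goal_sub_gS_le {b : PartialRealization n Γ} {i : Fin n} {γ₀ γ : Γ} (hi : b i = none)
    (h₀ : IsWorstState P.gS b i γ₀) (hγ : γ ≠ γ₀) :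
    ((P.Q * P.S.card : ℕ) : ℤ) - P.gS b ≤ 2 * delta P.gS b i γ := by
  obtain ⟨E, hE, hcard⟩ := card_consistent_setState P.S hi γ
  have h1 : (consistent P.S (setState b i γ₀)).card ≤ E.card :=
    Finset.card_le_card fun a ha => by
      rw [mem_consistent_setState hi] at ha
      rw [hE, ha.2]
      exact ⟨ha.1, hγ.symm⟩
  -- Two states cannot both keep more than half of the samples. If `γ` does, then `γ₀` does not, so
  -- `γ₀` closes half of the distance, and `γ` gains at least as much.
  by_cases h : 2 * (consistent P.S (setState b i γ)).card ≤ (consistent P.S b).card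
  · exact P.goal_sub_gS_le_of_card hi h
  · have h2 := P.goal_sub_gS_le_of_card hi (γ := γ₀) (by omega)
    have h3 := h₀ γ
    omega

theorem half_le_rho : ((1 / 2 : ℝ) : EReal) ≤ rho P.gS (P.Q * P.S.card) := by
  refine le_sInf ?_
  rintro r ⟨b, i, γ₀, γ, hb, hi, h₀, hγ, rfl⟩
  rw [EReal.coe_le_coe_iff]
  have h1 : (((P.Q * P.S.card : ℕ) : ℝ)) - P.gS b ≤ 2 * (delta P.gS b i γ : ℝ) := by
    exact_mod_cast P.goal_sub_gS_le hi h₀ hγ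
  have h2 : (P.gS b : ℝ) < ((P.Q * P.S.card : ℕ) : ℝ) := by exact_mod_cast hb
  rw [le_div_iff₀ (by linarith)]
  linarith

/-- Lets any competitor for `g` serve as the competitor in the analysis of Mixed Greedy on `g_S`. -/
theorem isStrategy_gS {T : DTree n Γ} (hT : IsStrategy P.g P.Q T) :
    IsStrategy P.gS (P.Q * P.S.card) T := by
  have key : ∀ b, CoversFrom P.g P.Q T b → CoversFrom P.gS (P.Q * P.S.card) T b := by
    intro b h
    clear hT
    induction T generalizing b with
    | leaf =>
      rw [CoversFrom] at h ⊢
      exact (P.gS_eq_iff b).2 (Or.inl h)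
    | node i child ih =>
      rw [CoversFrom] at h ⊢
      exact ⟨h.1, fun γ => ih γ _ (h.2 γ)⟩
  exact key _ hT

end ScenarioSC

end UtilityGS

/-! ### Completing the tree -/

section Complete

variable {n : ℕ} {Γ : Type u}

theorem coversFrom_chooseInOrder {g : PartialRealization n Γ → ℕ} {Q : ℕ}
    (hQ : HasGoalValue g Q) (l : List (Fin n)) (b : PartialRealization n Γ)
    (hl : ∀ i, b i = none → i ∈ l) : CoversFrom g Q (chooseInOrder g Q l b) b := by
  induction l generalizing b with
  | nil =>
    rw [chooseInOrder, CoversFrom]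
    exact hQ.eq_of_forall fun i hi => by simpa using hl i hi
  | cons i l ih =>
    rw [chooseInOrder]
    split_ifs with h1 h2
    · rwa [CoversFrom]
    · rw [CoversFrom]
      refine ⟨h2, fun γ => ih _ fun j hj => ?_⟩
      have hji : j ≠ i := by
        rintro rfl
        simp at hj
      rw [setState_of_ne _ _ hji] at hj
      exact (List.mem_cons.1 (hl j hj)).resolve_left hji
    · refine ih _ fun j hj => (List.mem_cons.1 (hl j hj)).resolve_left ?_
      rintro rfl
      exact h2 hj

theorem coversFrom_complete {g g' : PartialRealization n Γ → ℕ} {Q Q' : ℕ}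
    (hQ : HasGoalValue g Q) {order : List (Fin n)} (horder : ∀ i, i ∈ order) {T : DTree n Γ}
    {b : PartialRealization n Γ} (hT : CoversFrom g' Q' T b) :
    CoversFrom g Q (complete g Q order T b) b := by
  induction T generalizing b with
  | leaf => exact coversFrom_chooseInOrder hQ order b fun i _ => horder i
  | node i child ih =>
    rw [complete, CoversFrom]
    rw [CoversFrom] at hT
    exact ⟨hT.1, fun γ => ih γ (hT.2 γ)⟩

/-- On the sample, the completed tree costs as much as the original one. -/
theorem pathCost_complete (P : ScenarioSC n Γ) (c : Fin n → ℝ) (order : List (Fin n))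
    {T : DTree n Γ} {b : PartialRealization n Γ} (hT : CoversFrom P.gS (P.Q * P.S.card) T b)
    {a : Fin n → Γ} (ha : a ∈ consistent P.S b) :
    pathCost c (complete P.g P.Q order T b) a = pathCost c T a := by
  induction T generalizing b with
  | leaf =>
    rw [CoversFrom, P.gS_eq_iff] at hT
    -- The sample `a` itself is consistent with `b`, so `g_S` can have reached its goal only through
    -- `g`.
    have hb : P.g b = P.Q := hT.resolve_right (Finset.ne_empty_of_mem ha)
    rw [complete]
    cases order <;> simp [chooseInOrder, hb]
  | node i child ih =>
    rw [CoversFrom] at hT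
    rw [complete, pathCost, pathCost,
      ih (a i) (hT.2 (a i)) ((mem_consistent_setState hT.1).2 ⟨ha, rfl⟩)]

theorem consistent_allUnknown (S : Finset (Fin n → Γ)) : consistent S (allUnknown n Γ) = S := by
  ext a
  exact ⟨fun h => (mem_consistent.1 h).1, fun h => mem_consistent.2 ⟨h, fun _ hi => absurd rfl hi⟩⟩

theorem expectedCost_eq (S : Finset (Fin n → Γ)) (w : (Fin n → Γ) → ℕ) (c : Fin n → ℝ)
    (T : DTree n Γ) : expectedCost S w c T =
      (∑ a ∈ S, (w a : ℝ) * pathCost c T a) / ∑ a ∈ S, (w a : ℝ) := by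
  rw [expectedCost, Finset.sum_div]
  exact Finset.sum_congr rfl fun a _ => by ring

theorem ScenarioSC.expectedCost_complete_le [Finite Γ] (P : ScenarioSC n Γ) {T₀ T' : DTree n Γ}
    (order : List (Fin n))
    (hT₀ : MixedGreedy P.gS (P.Q * P.S.card) P.S P.w P.c (allUnknown n Γ) T₀)
    (hT' : IsStrategy P.g P.Q T') :
    expectedCost P.S P.w P.c (complete P.g P.Q order T₀ (allUnknown n Γ)) ≤
      24 * (1 + 1 / -Real.log (1 - alpha / 2)) *
        (1 + Real.log ((P.Q : ℝ) * (P.S.card : ℝ))) * expectedCost P.S P.w P.c T' := by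
  have hcost := hT₀.cost_le P.monotone_gS P.submodular_gS P.goal_gS P.c_pos
    (fun b i γ₀ γ _ hi h₀ hγ => P.goal_sub_gS_le hi h₀ hγ) (P.isStrategy_gS hT')
  -- The initial distance is at most `Qm`, and the level at the root is therefore `O(1 + log Qm)`.
  have hlevel := level_le (Nat.sub_le (P.Q * P.S.card) (P.gS (allUnknown n Γ)))
  rw [Nat.cast_mul] at hlevel
  rw [consistent_allUnknown] at hcost
  have hcomplete : ∑ a ∈ P.S, (P.w a : ℝ) *
      pathCost P.c (complete P.g P.Q order T₀ (allUnknown n Γ)) a =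
      ∑ a ∈ P.S, (P.w a : ℝ) * pathCost P.c T₀ a :=
    Finset.sum_congr rfl fun a ha => by
      rw [pathCost_complete P P.c order hT₀.coversFrom (by rwa [consistent_allUnknown])]
  rw [expectedCost_eq, expectedCost_eq, hcomplete, ← mul_div_assoc]
  refine div_le_div_of_nonneg_right (hcost.trans ?_)
    (Finset.sum_nonneg fun a _ => Nat.cast_nonneg _)
  have hnn : 0 ≤ ∑ a ∈ P.S, (P.w a : ℝ) * pathCost P.c T' a :=
    Finset.sum_nonneg fun a _ => mul_nonneg (Nat.cast_nonneg _) (pathCost_nonneg P.c_pos T' a)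
  exact mul_le_mul_of_nonneg_right (by linarith) hnn

end Complete

end ScenarioCover

theorem theorem2 :
    ∃ K : ℝ, 0 < K ∧
      ∀ (n : ℕ) (Γ : Type*) [Finite Γ] (P : ScenarioCover.ScenarioSC n Γ),
        (((1 / 2 : ℝ) : EReal) ≤ ScenarioCover.rho P.gS (P.Q * P.S.card)) ∧
        (∃ T, ScenarioCover.ScenarioMixedGreedy P T) ∧
        ∀ T, ScenarioCover.ScenarioMixedGreedy P T →
          ScenarioCover.IsStrategy P.g P.Q T ∧
          ∀ T', ScenarioCover.IsStrategy P.g P.Q T' →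
            ScenarioCover.expectedCost P.S P.w P.c T ≤
              K * (1 + Real.log ((P.Q : ℝ) * (P.S.card : ℝ))) *
                ScenarioCover.expectedCost P.S P.w P.c T' := by
  refine ⟨24 * (1 + 1 / -Real.log (1 - ScenarioCover.alpha / 2)), ?_, fun n Γ _ P => ⟨P.half_le_rho,
    ?_, ?_⟩⟩
  · have := one_div_pos.2 ScenarioCover.neg_log_pos
    positivity
  · obtain ⟨T₀, hT₀⟩ := ScenarioCover.exists_mixedGreedy (S := P.S) (w := P.w) P.monotone_gS
      P.submodular_gS P.goal_gS P.c_pos P.S_nonempty.choose (ScenarioCover.allUnknown n Γ)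
    exact ⟨_, T₀, List.finRange n, hT₀, List.nodup_finRange n, List.mem_finRange, rfl⟩
  · rintro T ⟨T₀, order, hT₀, -, horder, rfl⟩
    exact ⟨ScenarioCover.coversFrom_complete P.goal_g horder hT₀.coversFrom,
      fun T' hT' => P.expectedCost_complete_le order hT₀ hT'⟩
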